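/- Setting. Let $N$ be prime, let $\sigma$ be a uniformly random permutation of $\mathbb{Z}_N$ (the encoding of the group) and $d\in\mathbb{Z}_N$ an independent uniformly random secret discrete logarithm. A query is a pair $(a,b)\in\mathbb{Z}_N^2$ and is answered by $\sigma(ad+b)$; the encodings $\sigma(1)$ and $\sigma(d)$ are not given for free but count as the queries $(0,1)$ and $(1,0)$. A non-adaptive algorithm (without preprocessing) fixes all of its queries in advance and then outputs an element of $\mathbb{Z}_N$ computed from the answers. A non-adaptive $(S,T)$-algorithm $A=(A_0,A_1)$ consists of a preprocessing algorithm $A_0$, which reads all of $\sigma$ (but not $d$) and outputs an advice string $z=A_0(\sigma)$ of at most $S$ bits, and of an online algorithm $A_1$, which given $z$ is a non-adaptive algorithm with at most $T$ queries (so the queries may depend on $z$). Algorithms may be randomized, with coins shared by $A_0$ and $A_1$. The success probability is the probability, over $\sigma$, $d$ and the coins, that the output is $d$. Let $\mathrm{MaxS}_{\mathrm{DLOG}}(T)$ be the optimal success probability of a non-adaptive algorithm without preprocessing that makes at most $T$ queries. Theorem. (1) For every prime $N$ and all integers $S,T\ge 0$, the success probability of every non-adaptive $(S,T)$-algorithm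 is at most $$2\cdot \mathrm{MaxS}_{\mathrm{DLOG}}(T)+\frac{4\ln(2)\,ST}{N}+\frac{T^2}{N}.$$ (2) If $T\ge 1$, this quantity is at most $$\frac{3T^2}{N}+\frac{4\ln(2)\,ST}{N}.$$ (3) Consequently, baby-step giant-step is optimal among non-adaptive algorithms as long as $S=O(\sqrt N)$: for all $\varepsilon,C>0$ there is $c>0$ such that for every prime $N$, every non-adaptive $(S,T)$-algorithm with $T\ge 1$, $S\le C\sqrt N$ and success probability at least $\varepsilon$ has $T\ge c\sqrt N$; on the other hand, for every prime $N$ some deterministic non-adaptive algorithm without preprocessing makes at most $2\lceil\sqrt N\rceil$ queries and has success probability $1$. -/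

import Mathlib

/-- A deterministic non-adaptive algorithm in the generic group `ZMod N`: a list of queries
`(a, b)`, fixed in advance, and an output computed from all the answers.  The query `(a, b)` is
answered by `σ (a * d + b)`, where `σ` is the encoding of the group and `d` is the secret discrete
logarithm.  So `(0, b)` is a direct query to the encoding, and the usual inputs `σ 1` and `σ d` are
the answers to `(0, 1)` and `(1, 0)`; they are not given for free but count as queries. -/
structure OnlineAlg (N : ℕ) where
  numQueries : ℕ
  query : Fin numQueries → ZMod N × ZMod N
  output : (Fin numQueries → ZMod N) → ZMod N

/-- The output of the algorithm for the encoding `σ` and the secret `d`. -/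
def OnlineAlg.run {N : ℕ} (B : OnlineAlg N) (σ : Equiv.Perm (ZMod N)) (d : ZMod N) : ZMod N :=
  B.output fun i => σ ((B.query i).1 * d + (B.query i).2)

/-- A deterministic non-adaptive algorithm with preprocessing, a pair `(A₀, A₁)`: the first part
reads the whole encoding and outputs a bit string, the second is a non-adaptive algorithm whose
queries and output may depend on that string. -/
structure PreprocAlg (N : ℕ) where
  advice : Equiv.Perm (ZMod N) → List Bool
  online : List Bool → OnlineAlg N

/-- The output of the algorithm for the encoding `σ` and the secret `d`. -/
def PreprocAlg.run {N : ℕ} (A : PreprocAlg N) (σ : Equiv.Perm (ZMod N)) (d : ZMod N) : ZMod N :=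
  (A.online (A.advice σ)).run σ d

/-- At most `S` bits of advice and at most `T` online queries. -/
def PreprocAlg.IsST {N : ℕ} (A : PreprocAlg N) (S T : ℕ) : Prop :=
  (∀ σ, (A.advice σ).length ≤ S) ∧ ∀ z, (A.online z).numQueries ≤ T

/-- The probability that `f σ d = d` for an independent uniform encoding `σ` and a uniform
secret `d`. -/
noncomputable def dlogProb (N : ℕ) [NeZero N]
    (f : Equiv.Perm (ZMod N) → ZMod N → ZMod N) : ℝ :=
  ((Finset.univ.filter fun x : Equiv.Perm (ZMod N) × ZMod N => f x.1 x.2 = x.2).card : ℝ) /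
    Fintype.card (Equiv.Perm (ZMod N) × ZMod N)

/-- A randomized algorithm is a distribution over deterministic ones (the coins are tossed first).
This is its success probability, over the coins, the encoding and the secret. -/
noncomputable def onlineSuccess {N : ℕ} [NeZero N] (B : PMF (OnlineAlg N)) : ℝ :=
  ∑' b : OnlineAlg N, (B b).toReal * dlogProb N b.run

/-- The success probability of a randomized algorithm with preprocessing.  The coins are shared by
the preprocessing part and the online part. -/
noncomputable def preprocSuccess {N : ℕ} [NeZero N] (A : PMF (PreprocAlg N)) : ℝ :=
  ∑' a : PreprocAlg N, (A a).toReal * dlogProb N a.run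

/-- A (randomized) `(S, T)`-algorithm: for all coins, at most `S` bits of advice and at most `T`
queries. -/
def IsSTAlg {N : ℕ} (A : PMF (PreprocAlg N)) (S T : ℕ) : Prop :=
  ∀ a ∈ A.support, a.IsST S T

/-- The optimal success probability of a non-adaptive algorithm without preprocessing that makes at
most `T` queries. -/
noncomputable def maxSDLOG (N : ℕ) [NeZero N] (T : ℕ) : ℝ :=
  sSup {p : ℝ | ∃ B : PMF (OnlineAlg N),
    (∀ b ∈ B.support, b.numQueries ≤ T) ∧ p = onlineSuccess B}

/-! Fix an advice string `z` and let `G` be the set of encodings that produce it. A uniform member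
of `G` has relative entropy `log (N! / |G|)` with respect to a uniform permutation; averaged over
`z`, this is at most the logarithm of the number of advice strings, about `S log 2`. Once `z` is
fixed, so are the queries.

Split the queried points into fixed ones (slope zero) and moving ones, which depend on `d`. Two
queries of different slopes meet for at most one `d`, so all but `T.choose 2` secrets are free of
collisions. For a uniform encoding, even conditioned on its values at the fixed points, the answers
have the same law for every such secret, so the success probabilities over these secrets add up to
at most 1 (`OnlineAlg.sum_card_run_eq_le`). Passing from uniform encodings to `G` costs, for each
`d`, the relative entropy of the moving points given the fixed ones. This is a Donsker–Varadhan
inequality with parameter `μ` (`mul_card_filter_le`).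

It remains to bound the sum of these costs over `d`. A given point is a moving point for at most `T`
secrets. For a product reference measure, a Shearer-type inequality would bound the sum by `T` times
the whole relative entropy. A uniform permutation is not a product, but the bound survives with
factor `6 * T` (`sum_restrEntropy_le_six_mul`), or 4 for `T = 1`. The proof reveals the permutation
at one random point after another. The relative entropy of `Q` that is lost on revealing a point is
charged to the entropy gained; the crux is that points outside a small `Q` cost at most three times
what the points of `Q` carry (`sum_compl_restrEntropy_le`). Taking `μ = 2` then gives the stated
constants. -/

section

open Finset Equiv

/-! ### Relative entropy of restrictions of a random permutation. -/

/-- The members of `G` that agree with `σ` on `R`. -/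
def agreeing {α : Type*} [DecidableEq α] (G : Finset (Perm α)) (R : Finset α) (σ : Perm α) :
    Finset (Perm α) :=
  G.filter fun τ => ∀ x ∈ R, τ x = σ x

/-- Up to normalisation and an additive constant, the relative entropy of the restriction to `R` of
a uniform member of `G`, with respect to the restriction of a uniform permutation. -/
noncomputable def restrEntropy {α : Type*} [DecidableEq α] [Fintype α] (G : Finset (Perm α))
    (R : Finset α) : ℝ :=
  ∑ σ ∈ G, Real.log ((agreeing G R σ).card / (Fintype.card α - R.card).factorial)

section Counting

variable {α : Type*} [DecidableEq α]

theorem mem_agreeing {G : Finset (Perm α)} {R : Finset α} {σ τ : Perm α} :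
    τ ∈ agreeing G R σ ↔ τ ∈ G ∧ ∀ x ∈ R, τ x = σ x := by
  simp [agreeing]

theorem agreeing_self {G : Finset (Perm α)} {R : Finset α} {σ : Perm α} (h : σ ∈ G) :
    σ ∈ agreeing G R σ := mem_agreeing.2 ⟨h, fun _ _ => rfl⟩

theorem card_agreeing_pos {G : Finset (Perm α)} {R : Finset α} {σ : Perm α} (h : σ ∈ G) :
    (0 : ℝ) < (agreeing G R σ).card :=
  Nat.cast_pos.2 (card_pos.2 ⟨σ, agreeing_self h⟩)

theorem agreeing_congr {G : Finset (Perm α)} {R : Finset α} {σ τ : Perm α}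
    (h : ∀ x ∈ R, τ x = σ x) : agreeing G R τ = agreeing G R σ := by
  ext ρ
  simp only [mem_agreeing]
  exact and_congr_right fun _ => forall₂_congr fun x hx => by rw [h x hx]

theorem agreeing_agreeing (G : Finset (Perm α)) (R Q : Finset α) {σ τ : Perm α}
    (h : ∀ x ∈ R, τ x = σ x) :
    agreeing (agreeing G R σ) Q τ = agreeing G (Q ∪ R) τ := by
  ext ρ
  simp only [mem_agreeing, mem_union]
  constructor
  · rintro ⟨⟨h1, h2⟩, h3⟩
    exact ⟨h1, fun x hx => hx.elim (h3 x) fun hx => (h2 x hx).trans (h x hx).symm⟩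
  · rintro ⟨h1, h2⟩
    exact ⟨⟨h1, fun x hx => (h2 x (Or.inr hx)).trans (h x hx)⟩, fun x hx => h2 x (Or.inl hx)⟩

/-- Summation by averaging over the classes of agreement on `R`. -/
theorem sum_eq_sum_avg_agreeing (G : Finset (Perm α)) (R : Finset α) (f : Perm α → ℝ) :
    ∑ σ ∈ G, f σ = ∑ σ ∈ G, (∑ τ ∈ agreeing G R σ, f τ) / (agreeing G R σ).card := by
  symm
  calc ∑ σ ∈ G, (∑ τ ∈ agreeing G R σ, f τ) / (agreeing G R σ).card
      = ∑ σ ∈ G, ∑ τ ∈ agreeing G R σ, f τ / (agreeing G R τ).card := by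
        refine sum_congr rfl fun σ _ => ?_
        rw [sum_div]
        exact sum_congr rfl fun τ hτ => by rw [agreeing_congr (mem_agreeing.1 hτ).2]
    _ = ∑ τ ∈ G, ∑ σ ∈ agreeing G R τ, f τ / (agreeing G R τ).card := by
        refine sum_comm' fun σ τ => ?_
        simp only [mem_agreeing]
        constructor
        · rintro ⟨h1, h2, h3⟩; exact ⟨⟨h1, fun x hx => (h3 x hx).symm⟩, h2⟩
        · rintro ⟨⟨h1, h2⟩, h3⟩; exact ⟨h1, h3, fun x hx => (h2 x hx).symm⟩
    _ = ∑ τ ∈ G, f τ := by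
        refine sum_congr rfl fun τ hτ => ?_
        have := card_agreeing_pos (R := R) hτ
        rw [sum_const, nsmul_eq_mul]
        field_simp

theorem sum_agreeing_nonneg {G : Finset (Perm α)} (R : Finset α) {f : Perm α → ℝ}
    (h : ∀ σ ∈ G, 0 ≤ ∑ τ ∈ agreeing G R σ, f τ) : 0 ≤ ∑ σ ∈ G, f σ := by
  rw [sum_eq_sum_avg_agreeing G R]
  exact sum_nonneg fun σ hσ => div_nonneg (h σ hσ) (Nat.cast_nonneg _)

/-- Every attained value `w` collects `f w` exactly once, and unattained values only enlarge the
right side. This evaluates expectations of inverse likelihood ratios. -/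
theorem sum_div_card_fiber_le {β γ : Type*} [DecidableEq γ] (G : Finset β) (φ : β → γ)
    (W : Finset γ) (hW : ∀ τ ∈ G, φ τ ∈ W) (f : γ → ℝ) (hf : ∀ w ∈ W, 0 ≤ f w) :
    ∑ τ ∈ G, f (φ τ) / (G.filter fun τ' => φ τ' = φ τ).card ≤ ∑ w ∈ W, f w := by
  rw [← sum_fiberwise_of_maps_to hW]
  refine sum_le_sum fun w hw => ?_
  rcases (G.filter fun τ => φ τ = w).eq_empty_or_nonempty with h | h
  · rw [h]; simpa using hf w hw
  · have h0 : (0 : ℝ) < (G.filter fun τ => φ τ = w).card := Nat.cast_pos.2 (card_pos.2 h)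
    refine le_of_eq ?_
    calc ∑ τ ∈ G with φ τ = w, f (φ τ) / (G.filter fun τ' => φ τ' = φ τ).card
        = ∑ τ ∈ G with φ τ = w, f w / (G.filter fun τ' => φ τ' = w).card :=
          sum_congr rfl fun τ hτ => by rw [(mem_filter.1 hτ).2]
      _ = f w := by rw [sum_const, nsmul_eq_mul]; field_simp

theorem agreeing_insert_eq_filter (G : Finset (Perm α)) (R : Finset α) (p : α) {σ τ : Perm α}
    (h : ∀ x ∈ R, τ x = σ x) :
    agreeing G (insert p R) τ = (agreeing G R σ).filter fun τ' => τ' p = τ p := by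
  ext ρ
  simp only [mem_agreeing, mem_filter, mem_insert, forall_eq_or_imp]
  constructor
  · rintro ⟨h1, h2, h3⟩; exact ⟨⟨h1, fun x hx => (h3 x hx).trans (h x hx)⟩, h2⟩
  · rintro ⟨⟨h1, h2⟩, h3⟩; exact ⟨h1, h3, fun x hx => (h2 x hx).trans (h x hx).symm⟩

/-- Gibbs' inequality, from `log x ≥ 1 - 1/x`. In the applications `x` is the ratio of the actual
law to a reference of total mass at most 1. -/
theorem sum_log_nonneg_of_sum_inv_le {ι : Type*} (s : Finset ι) (x : ι → ℝ)
    (hx : ∀ i ∈ s, 0 < x i) (h : ∑ i ∈ s, (x i)⁻¹ ≤ s.card) : 0 ≤ ∑ i ∈ s, Real.log (x i) := by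
  have : ∑ i ∈ s, (1 - (x i)⁻¹) ≤ ∑ i ∈ s, Real.log (x i) :=
    sum_le_sum fun i hi => Real.one_sub_inv_le_log_of_pos (hx i hi)
  rw [sum_sub_distrib, sum_const, nsmul_eq_mul, mul_one] at this
  linarith

variable [Fintype α]

theorem restrEntropy_eq (G : Finset (Perm α)) (R : Finset α) :
    restrEntropy G R = ∑ σ ∈ G, Real.log (agreeing G R σ).card
      - G.card * Real.log (Fintype.card α - R.card).factorial := by
  rw [restrEntropy, ← nsmul_eq_mul, ← sum_const, ← sum_sub_distrib]
  refine sum_congr rfl fun σ hσ => ?_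
  rw [Real.log_div (card_agreeing_pos hσ).ne' (by positivity)]

theorem card_sub_card_insert {R : Finset α} {p : α} (hp : p ∉ R) :
    Fintype.card α - R.card = (Fintype.card α - (insert p R).card) + 1 := by
  have := card_le_univ (insert p R)
  rw [card_insert_of_notMem hp] at *
  omega

theorem restrEntropy_insert_sub (G : Finset (Perm α)) {R : Finset α} {p : α} (hp : p ∉ R) :
    restrEntropy G (insert p R) - restrEntropy G R =
      ∑ σ ∈ G, (Real.log (agreeing G (insert p R) σ).card - Real.log (agreeing G R σ).card
        + Real.log (Fintype.card α - R.card : ℕ)) := by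
  have h := card_sub_card_insert hp
  rw [restrEntropy_eq, restrEntropy_eq, sum_add_distrib, sum_sub_distrib, sum_const, nsmul_eq_mul]
  rw [h, Nat.factorial_succ, Nat.cast_mul, Real.log_mul (by positivity) (by positivity)]
  ring

/-- By the chain rule the difference is the relative entropy of `τ p`, given `τ` on `R`, with
respect to the uniform law on the values not yet used, so Gibbs' inequality applies. -/
theorem restrEntropy_le_insert (G : Finset (Perm α)) (R : Finset α) (p : α) :
    restrEntropy G R ≤ restrEntropy G (insert p R) := by
  by_cases hp : p ∈ R
  · rw [insert_eq_of_mem hp]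
  rw [← sub_nonneg, restrEntropy_insert_sub G hp]
  have hn : (0 : ℝ) < (Fintype.card α - R.card : ℕ) := by
    rw [card_sub_card_insert hp]; positivity
  refine sum_agreeing_nonneg R fun σ hσ => ?_
  have : ∑ τ ∈ agreeing G R σ, (Real.log (agreeing G (insert p R) τ).card
        - Real.log (agreeing G R τ).card + Real.log (Fintype.card α - R.card : ℕ)) =
      ∑ τ ∈ agreeing G R σ, Real.log ((agreeing G (insert p R) τ).card
        / (agreeing G R σ).card * (Fintype.card α - R.card : ℕ)) := by
    refine sum_congr rfl fun τ hτ => ?_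
    have hτ' := mem_agreeing.1 hτ
    have h1 := card_agreeing_pos (R := insert p R) hτ'.1
    have h2 := card_agreeing_pos (R := R) hσ
    rw [Real.log_mul (by positivity) hn.ne', Real.log_div h1.ne' h2.ne', agreeing_congr hτ'.2]
  rw [this]
  have h2 := card_agreeing_pos (R := R) hσ
  refine sum_log_nonneg_of_sum_inv_le _ _ (fun τ hτ => ?_) ?_
  · have h1 := card_agreeing_pos (R := insert p R) (mem_agreeing.1 hτ).1
    positivity
  · calc _ = ∑ τ ∈ agreeing G R σ, ((agreeing G R σ).card / (Fintype.card α - R.card : ℕ) : ℝ) /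
          ((agreeing G R σ).filter fun τ' => τ' p = τ p).card := by
          refine sum_congr rfl fun τ hτ => ?_
          have hτ' := mem_agreeing.1 hτ
          rw [← agreeing_insert_eq_filter G R p hτ'.2]
          have h1 := card_agreeing_pos (R := insert p R) hτ'.1
          field_simp
      _ ≤ ∑ w ∈ (R.image σ)ᶜ, ((agreeing G R σ).card / (Fintype.card α - R.card : ℕ) : ℝ) := by
          refine sum_div_card_fiber_le (agreeing G R σ) (fun τ => τ p) _ (fun τ hτ => ?_)
            (fun _ => ((agreeing G R σ).card / (Fintype.card α - R.card : ℕ) : ℝ))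
            (fun _ _ => by positivity)
          rw [mem_compl, mem_image]
          rintro ⟨x, hx, hxp⟩
          rw [← (mem_agreeing.1 hτ).2 x hx] at hxp
          exact hp (τ.injective hxp ▸ hx)
      _ = _ := by
          rw [sum_const, nsmul_eq_mul, card_compl, card_image_of_injective _ σ.injective]
          field_simp

theorem restrEntropy_mono (G : Finset (Perm α)) {R Q : Finset α} (h : R ⊆ Q) :
    restrEntropy G R ≤ restrEntropy G Q := by
  rw [← union_eq_right.2 h, union_comm]
  clear h
  induction Q using Finset.induction_on with
  | empty => simp
  | insert p Q _ ih => exact ih.trans (insert_union p Q R ▸ restrEntropy_le_insert G _ p)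

theorem restrEntropy_univ (G : Finset (Perm α)) :
    restrEntropy G univ = 0 := by
  refine sum_eq_zero fun σ hσ => ?_
  have : agreeing G univ σ = {σ} := by
    ext τ
    simp only [mem_agreeing, mem_univ, true_imp_iff, mem_singleton]
    refine ⟨fun h => Equiv.ext h.2, ?_⟩
    rintro rfl
    exact ⟨hσ, fun _ => rfl⟩
  simp [this]

/-- Together with the value 0 at `univ`, this makes the total entropy budget `|G| log (n! / |G|)`.
-/
theorem restrEntropy_empty (G : Finset (Perm α)) :
    restrEntropy G ∅ = G.card * Real.log (G.card / Fintype.card (Perm α)) := by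
  simp [restrEntropy, agreeing, Fintype.card_perm]

end Counting

/-! ### Scalar inequalities for the entropy comparison. -/

theorem log_le_half_sub_inv {y : ℝ} (hy : 1 ≤ y) : Real.log y ≤ (y - y⁻¹) / 2 := by
  have h0 : 0 < y := by linarith
  have := Real.self_le_sinh_iff.2 (Real.log_nonneg hy)
  rwa [Real.sinh_log h0] at this

theorem one_sub_mul_log_le {t M : ℝ} (ht : t < 1) (hM : M ≤ 1) :
    (1 - M) * Real.log ((1 - M) / (1 - t)) ≤ (M - t) ^ 2 / (1 - t) - (M - t) := by
  have h1 : 0 < 1 - t := by linarith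
  rcases hM.eq_or_lt with rfl | hM
  · simp only [sub_self, zero_mul]
    rw [pow_two, mul_div_assoc, div_self h1.ne']; simp
  · have := Real.log_le_sub_one_of_pos (div_pos (sub_pos.2 hM) h1)
    calc _ ≤ (1 - M) * ((1 - M) / (1 - t) - 1) := by gcongr
      _ = _ := by field_simp; ring

/-- The left side is the tangent at `M = t` of the right side: the two terms contribute slopes 3 and
1. The second term is bounded by `log y ≤ y - 1`, at the price of `(M - t) ^ 2 / (1 - t)`. A
second-order lower bound for `M log (M / t)` pays for this: the required `M + 4 * t ≤ 3` above `t`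
and `5 * t ≤ 3` below it both follow from `t ≤ 1 / 2`. -/
theorem four_mul_sub_le {t M : ℝ} (ht0 : 0 < t) (ht : t ≤ 1 / 2) (hM0 : 0 ≤ M) (hM : M ≤ 1) :
    4 * (M - t) ≤
      3 * (M * Real.log (M / t)) - (1 - M) * Real.log ((1 - M) / (1 - t)) := by
  have h1 := one_sub_mul_log_le (t := t) (by linarith) hM
  have h1t : 0 < 1 - t := by linarith
  suffices h : (M - t) ^ 2 / (1 - t) + 3 * (M - t) ≤ 3 * (M * Real.log (M / t)) by linarith
  rcases le_or_gt t M with h | h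
  · have hlog := Real.le_log_one_add_of_nonneg (x := M / t - 1)
      (by rw [sub_nonneg, le_div_iff₀ ht0]; linarith)
    rw [add_sub_cancel] at hlog
    have h2 : 2 * (M / t - 1) / (M / t - 1 + 2) = 2 * (M - t) / (M + t) := by
      field_simp; ring
    rw [h2] at hlog
    have h3 : M * (2 * (M - t) / (M + t)) ≤ M * Real.log (M / t) := by gcongr
    have h4 : M * (2 * (M - t) / (M + t)) = (M - t) + (M - t) ^ 2 / (M + t) := by
      field_simp; ring
    have h5 : (M - t) ^ 2 / (1 - t) ≤ (M - t) ^ 2 * (3 / (M + t)) := by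
      rw [div_eq_mul_one_div]
      gcongr ?_ * ?_
      rw [div_le_div_iff₀ h1t (by linarith)]
      linarith
    have h6 : (M - t) ^ 2 * (3 / (M + t)) = 3 * ((M - t) ^ 2 / (M + t)) := by ring
    linarith
  · rcases hM0.eq_or_lt with rfl | hM0
    · simp only [zero_sub, zero_div, Real.log_zero, mul_zero]
      have : (-t) ^ 2 / (1 - t) ≤ t := by
        rw [div_le_iff₀ h1t]; nlinarith
      linarith
    · have hlog := log_le_half_sub_inv (y := t / M) (by rw [le_div_iff₀ hM0]; linarith)
      rw [inv_div, ← inv_div, Real.log_inv] at hlog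
      have h3 : M * (-((t / M - M / t) / 2)) ≤ M * Real.log (M / t) := by
        gcongr; simp only [inv_div] at *; linarith
      have h4 : M * (-((t / M - M / t) / 2)) = (M - t) + (M - t) ^ 2 / (2 * t) := by
        field_simp; ring
      have h5 : (M - t) ^ 2 / (1 - t) ≤ (M - t) ^ 2 * (3 / (2 * t)) := by
        rw [div_eq_mul_one_div]
        gcongr ?_ * ?_
        rw [div_le_div_iff₀ h1t (by linarith)]
        linarith
      have h6 : (M - t) ^ 2 * (3 / (2 * t)) = 3 * ((M - t) ^ 2 / (2 * t)) := by ring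
      linarith

/-! ### Effect of conditioning on one further point. -/

section Conditional

variable {α : Type*} [DecidableEq α]

/-- The law of `τ p` for a uniform member `τ` of `G`. -/
noncomputable def pointLaw (G : Finset (Perm α)) (p w : α) : ℝ :=
  (G.filter fun τ => τ p = w).card / G.card

/-- The probability that `w` is in the image of `Q` under a uniform member of `G`. -/
noncomputable def hitProb (G : Finset (Perm α)) (Q : Finset α) (w : α) : ℝ :=
  ∑ i ∈ Q, pointLaw G i w

theorem pointLaw_nonneg (G : Finset (Perm α)) (p w : α) : 0 ≤ pointLaw G p w := by
  unfold pointLaw; positivity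

theorem pointLaw_pos {G : Finset (Perm α)} {τ : Perm α} (h : τ ∈ G) (p : α) :
    0 < pointLaw G p (τ p) := by
  have h1 : 0 < (G.filter fun τ' => τ' p = τ p).card := card_pos.2 ⟨τ, by simp [h]⟩
  have h2 : 0 < G.card := card_pos.2 ⟨τ, h⟩
  unfold pointLaw; positivity

theorem hitProb_nonneg (G : Finset (Perm α)) (Q : Finset α) (w : α) : 0 ≤ hitProb G Q w :=
  sum_nonneg fun _ _ => pointLaw_nonneg _ _ _

theorem hitProb_pos {G : Finset (Perm α)} {τ : Perm α} (h : τ ∈ G) {Q : Finset α} {i : α}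
    (hi : i ∈ Q) : 0 < hitProb G Q (τ i) :=
  (pointLaw_pos h i).trans_le
    (single_le_sum (f := fun i' => pointLaw G i' (τ i)) (fun _ _ => pointLaw_nonneg _ _ _) hi)

theorem sum_comp_apply {G : Finset (Perm α)} (hG : G.Nonempty) {V : Finset α} {p : α}
    (h : ∀ τ ∈ G, τ p ∈ V) (f : α → ℝ) :
    ∑ τ ∈ G, f (τ p) = G.card * ∑ w ∈ V, pointLaw G p w * f w := by
  have hg : (G.card : ℝ) ≠ 0 := Nat.cast_ne_zero.2 (card_pos.2 hG).ne'
  rw [← sum_fiberwise_of_maps_to h, mul_sum]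
  refine sum_congr rfl fun w _ => ?_
  calc ∑ τ ∈ G with τ p = w, f (τ p) = ∑ τ ∈ G with τ p = w, f w :=
        sum_congr rfl fun τ hτ => by rw [(mem_filter.1 hτ).2]
    _ = _ := by rw [sum_const, nsmul_eq_mul, pointLaw]; field_simp

theorem sum_pointLaw {G : Finset (Perm α)} (hG : G.Nonempty) {V : Finset α} {p : α}
    (h : ∀ τ ∈ G, τ p ∈ V) : ∑ w ∈ V, pointLaw G p w = 1 := by
  have hg : (G.card : ℝ) ≠ 0 := Nat.cast_ne_zero.2 (card_pos.2 hG).ne'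
  have := sum_comp_apply hG h fun _ => 1
  simp only [sum_const, nsmul_eq_mul, mul_one] at this
  exact (mul_left_cancel₀ hg ((mul_one _).trans this)).symm

variable [Fintype α]

/-- Each permutation takes the value `w` exactly once, and here never on `R`. -/
theorem hitProb_compl {G : Finset (Perm α)} (hG : G.Nonempty) {R : Finset α} {w : α}
    (h : ∀ τ ∈ G, ∀ x ∈ R, τ x ≠ w) : hitProb G Rᶜ w = 1 := by
  have hg : (G.card : ℝ) ≠ 0 := Nat.cast_ne_zero.2 (card_pos.2 hG).ne'
  simp only [hitProb, pointLaw]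
  rw [← sum_div, div_eq_one_iff_eq hg]
  simp only [card_filter, Nat.cast_sum]
  rw [sum_comm]
  calc _ = ∑ τ ∈ G, (1 : ℝ) := by
        refine sum_congr rfl fun τ hτ => ?_
        rw [sum_eq_single_of_mem (τ.symm w)]
        · simp
        · rw [mem_compl]; exact fun hx => h τ hτ _ hx (by simp)
        · intro x _ hx
          rw [if_neg fun e => hx (by rw [← e]; simp)]; simp
    _ = _ := by simp

theorem hitProb_compl_union {G : Finset (Perm α)} (hG : G.Nonempty) {Q R : Finset α}
    (hQ : Disjoint Q R) {w : α} (h : ∀ τ ∈ G, ∀ x ∈ R, τ x ≠ w) :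
    hitProb G (Q ∪ R)ᶜ w = 1 - hitProb G Q w := by
  have : Rᶜ = (Q ∪ R)ᶜ ∪ Q := by
    ext x
    have : x ∈ Q → x ∉ R := fun h => disjoint_left.1 hQ h
    simp only [mem_union, mem_compl]; tauto
  rw [← hitProb_compl hG h, this, hitProb, hitProb, hitProb, sum_union, add_sub_cancel_right]
  rw [disjoint_left]; intro x; simp only [mem_compl, mem_union]; tauto

/-- Conditioning on one more point `p` outside `Q` decreases the relative entropy of the
restriction to `Q`, on average over `p`, by little. -/
theorem sum_log_agreeing_nonneg {G : Finset (Perm α)} {Q R : Finset α} (hQ : Disjoint Q R)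
    (hG : ∀ σ ∈ G, ∀ τ ∈ G, ∀ x ∈ R, τ x = σ x) (hq : 2 * Q.card ≤ Fintype.card α - R.card) :
    0 ≤ ∑ τ ∈ G, (∑ p ∈ (Q ∪ R)ᶜ,
        (Real.log (agreeing G (insert p Q) τ).card + Real.log G.card
          - Real.log (agreeing G Q τ).card - Real.log (agreeing G {p} τ).card
          - Real.log (Fintype.card α - R.card : ℕ)
          + Real.log (Fintype.card α - (Q ∪ R).card : ℕ))
      + 3 * ∑ i ∈ Q, (Real.log (agreeing G {i} τ).card - Real.log G.card
          + Real.log (Fintype.card α - R.card : ℕ))) := by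
  rcases Q.eq_empty_or_nonempty with rfl | hQne
  · simp [agreeing]
  rcases G.eq_empty_or_nonempty with rfl | hGne
  · simp
  obtain ⟨σ₀, hσ₀⟩ := hGne
  have hGne : G.Nonempty := ⟨σ₀, hσ₀⟩
  have hg : (0 : ℝ) < G.card := Nat.cast_pos.2 (card_pos.2 hGne)
  have hq0 : 0 < Q.card := card_pos.2 hQne
  set n := Fintype.card α - R.card with hn
  have hcard : Fintype.card α - (Q ∪ R).card = n - Q.card := by
    rw [card_union_of_disjoint hQ]; omega
  set V := (R.image σ₀)ᶜ with hV
  have hVcard : V.card = n := by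
    rw [hV, card_compl, card_image_of_injective _ σ₀.injective]
  have hGV : ∀ τ ∈ G, ∀ p ∉ R, τ p ∈ V := by
    intro τ hτ p hp
    rw [hV, mem_compl, mem_image]
    rintro ⟨x, hx, hxp⟩
    rw [← hG σ₀ hσ₀ τ hτ x hx] at hxp
    exact hp (τ.injective hxp ▸ hx)
  have hVG : ∀ w ∈ V, ∀ τ ∈ G, ∀ x ∈ R, τ x ≠ w := by
    intro w hw τ hτ x hx e
    rw [hV, mem_compl] at hw
    exact hw (mem_image.2 ⟨x, hx, by rw [← hG σ₀ hσ₀ τ hτ x hx, e]⟩)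
  have hQR : ∀ i ∈ Q, i ∉ R := fun i hi => disjoint_left.1 hQ hi
  have hPR : ∀ p ∈ (Q ∪ R)ᶜ, p ∉ R := fun p hp h => (mem_compl.1 hp) (mem_union_right _ h)
  set M := hitProb G Q with hMdef
  have hM1 : ∀ w ∈ V, hitProb G (Q ∪ R)ᶜ w = 1 - M w :=
    fun w hw => hitProb_compl_union hGne hQ (hVG w hw)
  have hMle : ∀ w ∈ V, M w ≤ 1 := fun w hw => by
    have := hM1 w hw; have := hitProb_nonneg G (Q ∪ R)ᶜ w; linarith
  have hMsum : ∑ w ∈ V, M w = Q.card := by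
    simp only [hMdef, hitProb]
    rw [sum_comm, sum_congr rfl fun i hi => sum_pointLaw hGne fun τ hτ => hGV τ hτ i (hQR i hi)]
    simp
  have hM1pos : ∀ τ ∈ G, ∀ p ∈ (Q ∪ R)ᶜ, 0 < 1 - M (τ p) := fun τ hτ p hp => by
    rw [← hM1 _ (hGV τ hτ p (hPR p hp))]; exact hitProb_pos hτ hp
  have hsing : ∀ τ p, (agreeing G {p} τ).card = pointLaw G p (τ p) * G.card := by
    intro τ p
    rw [pointLaw, div_mul_cancel₀ _ hg.ne']
    congr 2
    ext; simp [agreeing]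
  have hnpos : (0 : ℝ) < n := Nat.cast_pos.2 (by omega)
  have hnq : (0 : ℝ) < (n - Q.card : ℕ) := Nat.cast_pos.2 (by omega)
  have hqR : (0 : ℝ) < Q.card := Nat.cast_pos.2 hq0
  -- Given `τ` on `Q`, compare the law of `τ p` with the weights `pointLaw G p w / (1 - M w)`. For a
  -- single `p` these need not have mass at most 1, but summed over `p` outside `Q ∪ R` they give 1
  -- for each free value `w`, which is enough for Gibbs' inequality.
  have hA : 0 ≤ ∑ τ ∈ G, ∑ p ∈ (Q ∪ R)ᶜ, Real.log ((agreeing G (insert p Q) τ).card *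
      (1 - M (τ p)) / ((agreeing G Q τ).card * pointLaw G p (τ p))) := by
    refine sum_agreeing_nonneg Q fun σ hσ => ?_
    have hc := card_agreeing_pos (R := Q) hσ
    rw [← sum_product']
    refine sum_log_nonneg_of_sum_inv_le _ _ ?_ ?_
    · rintro ⟨τ, p⟩ h
      obtain ⟨h1, h2⟩ := mem_product.1 h
      have h1 := (mem_agreeing.1 h1).1
      have := hM1pos τ h1 p h2
      have := card_agreeing_pos (R := Q) h1
      have := card_agreeing_pos (R := insert p Q) h1
      have := pointLaw_pos h1 p
      positivity
    · rw [card_product, sum_product_right]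
      have hW : ∀ w ∈ ((Q ∪ R).image σ)ᶜ, w ∈ V := by
        intro w hw
        have := hGV σ hσ (σ.symm w)
        rw [Equiv.apply_symm_apply] at this
        refine this fun h => (mem_compl.1 hw) (mem_image.2 ⟨_, mem_union_right _ h, by simp⟩)
      calc _ ≤ ∑ p ∈ (Q ∪ R)ᶜ, ∑ w ∈ ((Q ∪ R).image σ)ᶜ,
              (agreeing G Q σ).card * (pointLaw G p w / (1 - M w)) := by
            refine sum_le_sum fun p hp => ?_
            refine le_trans (le_of_eq ?_) (sum_div_card_fiber_le (agreeing G Q σ) (fun τ => τ p)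
              ((Q ∪ R).image σ)ᶜ (fun τ hτ => ?_)
              (fun w => (agreeing G Q σ).card * (pointLaw G p w / (1 - M w))) (fun w hw => ?_))
            · refine sum_congr rfl fun τ hτ => ?_
              have hτ' := mem_agreeing.1 hτ
              rw [← agreeing_insert_eq_filter G Q p hτ'.2, agreeing_congr hτ'.2]
              have h1 := card_agreeing_pos (R := insert p Q) hτ'.1
              have := hM1pos τ hτ'.1 p hp
              have := pointLaw_pos hτ'.1 p
              field_simp
            · have hτ' := mem_agreeing.1 hτ
              rw [mem_compl, mem_image]
              rintro ⟨x, hx, hxp⟩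
              have : σ x = τ x := by
                rcases mem_union.1 hx with h | h
                · exact (hτ'.2 x h).symm
                · exact hG τ hτ'.1 σ hσ x h
              rw [this] at hxp
              exact (mem_compl.1 hp) (τ.injective hxp ▸ hx)
            · exact mul_nonneg hc.le (div_nonneg (pointLaw_nonneg _ _ _)
                (by have := hMle w (hW w hw); linarith))
        _ = (agreeing G Q σ).card * ∑ w ∈ ((Q ∪ R).image σ)ᶜ, (1 - M w) / (1 - M w) := by
            rw [sum_comm, mul_sum]
            refine sum_congr rfl fun w hw => ?_
            rw [← mul_sum, ← sum_div, ← hM1 w (hW w hw)]; rfl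
        _ ≤ (agreeing G Q σ).card * ∑ w ∈ ((Q ∪ R).image σ)ᶜ, 1 := by
            gcongr with w
            exact div_self_le_one _
        _ = _ := by
            rw [sum_const, nsmul_eq_mul, mul_one, card_compl, card_compl,
              card_image_of_injective _ σ.injective, Nat.cast_mul]
  -- Gibbs' inequality for the law of each `τ i`, `i ∈ Q`, against the average law `M / |Q|` of
  -- these points.
  have hB : 0 ≤ ∑ τ ∈ G, ∑ i ∈ Q, Real.log (Q.card * pointLaw G i (τ i) / M (τ i)) := by
    rw [← sum_product']
    refine sum_log_nonneg_of_sum_inv_le _ _ ?_ ?_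
    · rintro ⟨τ, i⟩ h
      obtain ⟨h1, h2⟩ := mem_product.1 h
      have := hitProb_pos h1 h2
      have := pointLaw_pos h1 i
      positivity
    · rw [card_product, sum_product_right]
      calc _ ≤ ∑ i ∈ Q, ∑ w ∈ V, G.card * M w / Q.card := by
            refine sum_le_sum fun i hi => ?_
            refine le_trans (le_of_eq ?_) (sum_div_card_fiber_le G (fun τ => τ i) V
              (fun τ hτ => hGV τ hτ i (hQR i hi)) (fun w => G.card * M w / Q.card)
              (fun w _ => by have := hitProb_nonneg G Q w; positivity))
            refine sum_congr rfl fun τ hτ => ?_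
            rw [pointLaw]
            have := pointLaw_pos hτ i
            have : ((G.filter fun τ' => τ' i = τ i).card : ℝ) ≠ 0 := by
              intro h; rw [pointLaw, h] at this; simp at this
            field_simp
        _ = _ := by
            rw [sum_const, ← sum_div, ← mul_sum, hMsum, nsmul_eq_mul, Nat.cast_mul]
            field_simp
  -- What is left after `hA` and three times `hB` depends on the hitting probabilities `M` only, and
  -- is compared value by value with the uniform case `M = |Q| / n`.
  have hC : 0 ≤ ∑ τ ∈ G, (∑ p ∈ (Q ∪ R)ᶜ,
        -Real.log ((1 - M (τ p)) / ((n - Q.card : ℕ) / n))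
      + 3 * ∑ i ∈ Q, Real.log (M (τ i) / (Q.card / n))) := by
    have ht : ((n - Q.card : ℕ) : ℝ) / n = 1 - Q.card / n := by
      rw [Nat.cast_sub (by omega)]; field_simp
    rw [sum_add_distrib, sum_comm, ← mul_sum]
    rw [sum_comm (s := G) (t := Q)]
    rw [sum_congr rfl fun p hp => sum_comp_apply hGne (fun τ hτ => hGV τ hτ p (hPR p hp))
      (fun w => -Real.log ((1 - M w) / ((n - Q.card : ℕ) / n)))]
    rw [sum_congr rfl fun p hp => sum_comp_apply hGne (fun τ hτ => hGV τ hτ p (hQR p hp))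
      (fun w => Real.log (M w / (Q.card / n)))]
    rw [← mul_sum, ← mul_sum, sum_comm, sum_comm (s := Q)]
    have key : 0 ≤ ∑ w ∈ V, (3 * (M w * Real.log (M w / (Q.card / n)))
        - (1 - M w) * Real.log ((1 - M w) / ((n - Q.card : ℕ) / n))) := by
      -- The tangent terms cancel because `M` has total mass `|Q|` on the `n` values of `V`.
      calc 0 = ∑ w ∈ V, 4 * (M w - Q.card / n) := by
            rw [← mul_sum, sum_sub_distrib, hMsum, sum_const, hVcard, nsmul_eq_mul]
            field_simp; simp
        _ ≤ _ := by
            refine sum_le_sum fun w hw => ?_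
            rw [ht]
            refine four_mul_sub_le (by positivity) ?_ (hitProb_nonneg _ _ _) (hMle w hw)
            rw [div_le_div_iff₀ hnpos two_pos]
            have : ((2 * Q.card : ℕ) : ℝ) ≤ n := Nat.cast_le.2 hq
            push_cast at this; linarith
    refine (mul_nonneg hg.le key).trans (le_of_eq ?_)
    rw [mul_left_comm 3, ← mul_add]
    congr 1
    rw [mul_sum, ← sum_add_distrib]
    refine sum_congr rfl fun w hw => ?_
    rw [← sum_mul, ← sum_mul, ← hM1 w hw]
    simp only [hMdef, hitProb]
    ring
  refine (add_nonneg (add_nonneg hA hC) (mul_nonneg (zero_le_three (α := ℝ)) hB)).trans (le_of_eq ?_)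
  rw [mul_sum, ← sum_add_distrib, ← sum_add_distrib]
  refine sum_congr rfl fun τ hτ => ?_
  rw [hcard, ← add_assoc, ← sum_add_distrib, add_assoc, ← mul_add, ← sum_add_distrib]
  congr 1
  · refine sum_congr rfl fun p hp => ?_
    have h1 := card_agreeing_pos (R := insert p Q) hτ
    have h2 := card_agreeing_pos (R := Q) hτ
    have h3 := hM1pos τ hτ p hp
    have h4 := pointLaw_pos hτ p
    rw [hsing, Real.log_div (by positivity) (by positivity), Real.log_mul h1.ne' h3.ne',
      Real.log_mul h2.ne' h4.ne', Real.log_div h3.ne' (by positivity),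
      Real.log_div hnq.ne' hnpos.ne', Real.log_mul h4.ne' hg.ne']
    ring
  · congr 1
    refine sum_congr rfl fun i hi => ?_
    have h3 := hitProb_pos hτ hi
    have h4 := pointLaw_pos hτ i
    rw [hsing, Real.log_div h3.ne' (by positivity), Real.log_div hqR.ne' hnpos.ne',
      Real.log_div (by positivity) h3.ne', Real.log_mul hqR.ne' h4.ne', Real.log_mul h4.ne' hg.ne']
    ring

/-- Once the values on `R` are fixed this is `sum_log_agreeing_nonneg` for the class of agreement on
`R`; averaging over the classes gives the general case. -/
theorem sum_compl_restrEntropy_le (G : Finset (Perm α)) {Q R : Finset α} (hQ : Disjoint Q R)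
    (hq : 2 * Q.card ≤ Fintype.card α - R.card) :
    ∑ p ∈ (Q ∪ R)ᶜ, ((restrEntropy G (Q ∪ R) - restrEntropy G R)
        - (restrEntropy G (insert p (Q ∪ R)) - restrEntropy G (insert p R))) ≤
      3 * ∑ i ∈ Q, (restrEntropy G (insert i R) - restrEntropy G R) := by
  rw [← sub_nonneg]
  have h : ∀ p ∈ (Q ∪ R)ᶜ, (restrEntropy G (Q ∪ R) - restrEntropy G R)
        - (restrEntropy G (insert p (Q ∪ R)) - restrEntropy G (insert p R)) =
      -∑ τ ∈ G, (Real.log (agreeing G (insert p (Q ∪ R)) τ).card + Real.log (agreeing G R τ).card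
          - Real.log (agreeing G (Q ∪ R) τ).card - Real.log (agreeing G (insert p R) τ).card
          - Real.log (Fintype.card α - R.card : ℕ)
          + Real.log (Fintype.card α - (Q ∪ R).card : ℕ)) := by
    intro p hp
    have h1 := restrEntropy_insert_sub G (mem_compl.1 hp)
    have h2 := restrEntropy_insert_sub G (R := R) (p := p)
      fun h => mem_compl.1 hp (mem_union_right _ h)
    have : ∀ a b c d : ℝ, (a - b) - (c - d) = (d - b) - (c - a) := fun _ _ _ _ => by ring
    rw [this, h1, h2, ← sum_sub_distrib, ← sum_neg_distrib]
    exact sum_congr rfl fun τ _ => by ring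
  rw [sum_congr rfl h, sum_congr rfl fun i hi => restrEntropy_insert_sub G (disjoint_left.1 hQ hi),
    sum_neg_distrib, sub_neg_eq_add, sum_comm, sum_comm (s := (Q ∪ R)ᶜ), mul_sum, ← sum_add_distrib]
  refine sum_agreeing_nonneg R fun σ hσ => ?_
  refine (sum_log_agreeing_nonneg (G := agreeing G R σ) hQ ?_ hq).trans (le_of_eq ?_)
  · intro τ hτ τ' hτ' x hx
    rw [(mem_agreeing.1 hτ).2 x hx, (mem_agreeing.1 hτ').2 x hx]
  · refine sum_congr rfl fun τ hτ => ?_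
    have hτ' := (mem_agreeing.1 hτ).2
    simp only [agreeing_agreeing G R _ hτ', insert_union, singleton_union, agreeing_congr hτ']
    ring

end Conditional

/-! ### A Shearer-type inequality for permutations. -/

section Shearer

variable {α : Type*} [DecidableEq α] [Fintype α]

/-- A point of `Q` lowers the conditional entropy of `Q` by exactly its own. The points outside `Q`
are charged threefold to `Q` if `Q` fills at most half of the free points. Otherwise each is charged
to itself, since a loss never exceeds the entropy of the revealed point. -/
theorem sum_restrEntropy_decrease_le (G : Finset (Perm α)) (Q R : Finset α) :
    ∑ p ∈ Rᶜ, ((restrEntropy G (Q ∪ R) - restrEntropy G R)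
        - (restrEntropy G (insert p (Q ∪ R)) - restrEntropy G (insert p R))) ≤
      ∑ p ∈ Rᶜ, (restrEntropy G (insert p R) - restrEntropy G R) *
        ((if p ∈ Q then 1 else 0)
          + 3 * (if p ∈ Q ∧ 2 * (Q \ R).card ≤ Fintype.card α - R.card then 1 else 0)
          + (if p ∉ Q ∧ Fintype.card α - R.card < 2 * (Q \ R).card then 1 else 0)) := by
  have hsplit : Rᶜ = (Q ∪ R)ᶜ ∪ (Q \ R) := by
    ext x; simp only [mem_union, mem_compl, mem_sdiff]; tauto
  have hdisj : Disjoint (Q ∪ R)ᶜ (Q \ R) := by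
    rw [disjoint_left]; intro x; simp only [mem_union, mem_compl, mem_sdiff]; tauto
  rw [hsplit, sum_union hdisj, sum_union hdisj]
  have hin : ∑ p ∈ Q \ R, ((restrEntropy G (Q ∪ R) - restrEntropy G R)
        - (restrEntropy G (insert p (Q ∪ R)) - restrEntropy G (insert p R))) =
      ∑ p ∈ Q \ R, (restrEntropy G (insert p R) - restrEntropy G R) := by
    refine sum_congr rfl fun p hp => ?_
    rw [insert_eq_of_mem (mem_union_left _ (mem_sdiff.1 hp).1)]
    ring
  have hpQ : ∀ p ∈ (Q ∪ R)ᶜ, p ∉ Q := fun p hp h => mem_compl.1 hp (mem_union_left _ h)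
  by_cases hq : 2 * (Q \ R).card ≤ Fintype.card α - R.card
  · have h1 := sum_compl_restrEntropy_le G (sdiff_disjoint (s := R) (t := Q)) hq
    rw [sdiff_union_self_eq_union] at h1
    refine (add_le_add h1 hin.le).trans (le_of_eq ?_)
    rw [mul_sum, ← sum_add_distrib, eq_comm]
    refine (add_eq_right.2 (sum_eq_zero fun p hp => ?_)).trans (sum_congr rfl fun p hp => ?_)
    · have := hpQ p hp
      rw [if_neg this, if_neg (fun h => this h.1), if_neg (by omega)]
      norm_num
    · rw [if_pos (mem_sdiff.1 hp).1, if_pos ⟨(mem_sdiff.1 hp).1, hq⟩, if_neg (by omega)]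
      ring
  · rw [hin]
    refine add_le_add (sum_le_sum fun p hp => ?_) (le_of_eq (sum_congr rfl fun p hp => ?_))
    · have := hpQ p hp
      rw [if_neg this, if_neg (fun h => this h.1), if_pos ⟨this, by omega⟩]
      have := restrEntropy_le_insert G (Q ∪ R) p
      linarith
    · have := (mem_sdiff.1 hp).1
      rw [if_pos this, if_neg (fun h => hq h.2), if_neg (fun h => h.1 this)]
      norm_num

/-- Subadditivity of relative entropy for restrictions of a random permutation to subsets. -/
theorem sum_restrEntropy_le {ι : Type*} (G : Finset (Perm α)) (F : Finset α) (s : Finset ι)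
    (Q : ι → Finset α) (K : ℝ)
    (hK : ∀ R, F ⊆ R → ∀ p ∉ R, ((s.filter fun j => p ∈ Q j).card : ℝ)
      + 3 * (s.filter fun j => p ∈ Q j ∧ 2 * (Q j \ R).card ≤ Fintype.card α - R.card).card
      + (s.filter fun j => p ∉ Q j ∧ Fintype.card α - R.card < 2 * (Q j \ R).card).card ≤ K) :
    ∑ j ∈ s, (restrEntropy G (Q j ∪ F) - restrEntropy G F) ≤
      K * (restrEntropy G univ - restrEntropy G F) := by
  -- Induction on the number of unrevealed points. The inequality is summed over all choices of the
  -- next point `p`; in each summand the entropy of `p` plus the remaining budget is the current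
  -- budget.
  suffices H : ∀ m, ∀ R, F ⊆ R → Rᶜ.card = m →
      ∑ j ∈ s, (restrEntropy G (Q j ∪ R) - restrEntropy G R) ≤
      K * (restrEntropy G univ - restrEntropy G R) from H _ F subset_rfl rfl
  intro m
  induction m with
  | zero =>
    intro R _ h
    have : R = univ := by rwa [card_eq_zero, compl_eq_empty_iff] at h
    subst this
    simp [union_eq_right.2 (subset_univ _)]
  | succ m ih =>
    intro R hFR hR
    have hstep : ∑ p ∈ Rᶜ, ∑ j ∈ s, ((restrEntropy G (Q j ∪ R) - restrEntropy G R)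
        - (restrEntropy G (insert p (Q j ∪ R)) - restrEntropy G (insert p R))) ≤
        ∑ p ∈ Rᶜ, (restrEntropy G (insert p R) - restrEntropy G R) * K := by
      rw [sum_comm]
      refine (sum_le_sum fun j _ => sum_restrEntropy_decrease_le G (Q j) R).trans ?_
      rw [sum_comm]
      refine sum_le_sum fun p hp => ?_
      rw [← mul_sum]
      refine mul_le_mul_of_nonneg_left (le_trans (le_of_eq ?_) (hK R hFR p (mem_compl.1 hp)))
        (sub_nonneg.2 (restrEntropy_le_insert G R p))
      rw [sum_add_distrib, sum_add_distrib, ← mul_sum, sum_boole, sum_boole, sum_boole]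
    have hih : ∑ p ∈ Rᶜ, ∑ j ∈ s, (restrEntropy G (insert p (Q j ∪ R)) - restrEntropy G (insert p R))
        ≤ ∑ p ∈ Rᶜ, K * (restrEntropy G univ - restrEntropy G (insert p R)) := by
      refine sum_le_sum fun p hp => ?_
      have := ih (insert p R) (hFR.trans (subset_insert _ _)) (by
        rw [compl_insert, card_erase_of_mem hp, hR]; rfl)
      simpa only [union_insert] using this
    have hsum := add_le_add hstep hih
    rw [← sum_add_distrib, ← sum_add_distrib] at hsum
    simp only [← sum_add_distrib, sub_add_cancel] at hsum
    have hconst : ∀ p ∈ Rᶜ, (restrEntropy G (insert p R) - restrEntropy G R) * K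
        + K * (restrEntropy G univ - restrEntropy G (insert p R)) =
        K * (restrEntropy G univ - restrEntropy G R) := fun p _ => by ring
    rw [sum_const, sum_congr rfl hconst, sum_const, nsmul_eq_mul, nsmul_eq_mul] at hsum
    exact le_of_mul_le_mul_left hsum (by rw [hR]; positivity)

/-- The factor is `1 + 3 + 2` times `T`: the sets have total size at most `T` times the number of
free points, so at most `2 * T` of them fill more than half of these. -/
theorem sum_restrEntropy_le_six_mul {ι : Type*} (G : Finset (Perm α)) (F : Finset α)
    (s : Finset ι) (Q : ι → Finset α) (T : ℕ)
    (hT : ∀ p ∉ F, (s.filter fun j => p ∈ Q j).card ≤ T) :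
    ∑ j ∈ s, (restrEntropy G (Q j ∪ F) - restrEntropy G F) ≤
      6 * T * (restrEntropy G univ - restrEntropy G F) := by
  refine sum_restrEntropy_le G F s Q _ fun R hFR p hp => ?_
  have hT' : ∀ p ∉ R, (s.filter fun j => p ∈ Q j).card ≤ T := fun p hp => hT p fun h => hp (hFR h)
  have h1 := hT' p hp
  have h2 : (s.filter fun j => p ∈ Q j ∧ 2 * (Q j \ R).card ≤ Fintype.card α - R.card).card ≤ T :=
    (card_le_card (monotone_filter_right s fun _ _ h => h.1)).trans h1
  have h3 : (s.filter fun j => p ∉ Q j ∧ Fintype.card α - R.card < 2 * (Q j \ R).card).card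
      ≤ 2 * T := by
    have hn : 0 < Fintype.card α - R.card := by rw [card_sub_card_insert hp]; omega
    refine le_of_mul_le_mul_right ?_ hn
    calc _ ≤ ∑ j ∈ s with p ∉ Q j ∧ Fintype.card α - R.card < 2 * (Q j \ R).card,
            2 * (Q j \ R).card := by
          rw [← smul_eq_mul, ← sum_const]
          exact sum_le_sum fun j hj => (mem_filter.1 hj).2.2.le
      _ ≤ ∑ j ∈ s, 2 * (Q j \ R).card := sum_le_sum_of_subset (filter_subset _ _)
      _ = 2 * ∑ p ∈ Rᶜ, (s.filter fun j => p ∈ Q j).card := by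
          rw [← mul_sum]
          congr 1
          refine Eq.trans ?_
            (sum_card_bipartiteAbove_eq_sum_card_bipartiteBelow fun j p => p ∈ Q j)
          refine sum_congr rfl fun j _ => congrArg card ?_
          ext x; simp [bipartiteAbove, and_comm]
      _ ≤ 2 * ∑ p ∈ Rᶜ, T := by gcongr with p hp; exact hT' p (mem_compl.1 hp)
      _ = _ := by rw [sum_const, card_compl, smul_eq_mul]; ring
  have h1' : ((s.filter fun j => p ∈ Q j).card : ℝ) ≤ T := Nat.cast_le.2 h1
  have h2' : ((s.filter fun j => p ∈ Q j ∧ 2 * (Q j \ R).card ≤ Fintype.card α - R.card).card : ℝ)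
    ≤ T := Nat.cast_le.2 h2
  have h3' : ((s.filter fun j => p ∉ Q j ∧ Fintype.card α - R.card < 2 * (Q j \ R).card).card : ℝ)
    ≤ (2 * T : ℕ) := Nat.cast_le.2 h3
  push_cast at h3'
  linarith

theorem sum_restrEntropy_le_four_mul {ι : Type*} (G : Finset (Perm α)) (F : Finset α)
    (s : Finset ι) (Q : ι → Finset α) (hQ : ∀ j ∈ s, (Q j).card ≤ 1)
    (hT : ∀ p ∉ F, (s.filter fun j => p ∈ Q j).card ≤ 1) :
    ∑ j ∈ s, (restrEntropy G (Q j ∪ F) - restrEntropy G F) ≤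
      4 * (restrEntropy G univ - restrEntropy G F) := by
  refine sum_restrEntropy_le G F s Q _ fun R hFR p hp => ?_
  have h1 := hT p fun h => hp (hFR h)
  have h2 : (s.filter fun j => p ∈ Q j ∧ 2 * (Q j \ R).card ≤ Fintype.card α - R.card).card ≤ 1 :=
    (card_le_card (monotone_filter_right s fun _ _ h => h.1)).trans h1
  -- A set of at most one point fills more than half of the free points only if it is all of them,
  -- and then it contains `p`.
  have h3 : (s.filter fun j => p ∉ Q j ∧ Fintype.card α - R.card < 2 * (Q j \ R).card) = ∅ := by
    refine filter_eq_empty_iff.2 fun j hj ⟨hpj, hlt⟩ => ?_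
    have h4 : (Q j \ R).card ≤ 1 := (card_le_card sdiff_subset).trans (hQ j hj)
    have h5 : (insert p (Q j \ R)).card ≤ Fintype.card α - R.card := by
      rw [← card_compl]
      refine card_le_card fun x hx => ?_
      rcases mem_insert.1 hx with rfl | hx
      · exact mem_compl.2 hp
      · exact mem_compl.2 (mem_sdiff.1 hx).2
    rw [card_insert_of_notMem fun h => hpj (mem_sdiff.1 h).1] at h5
    omega
  have h1' : ((s.filter fun j => p ∈ Q j).card : ℝ) ≤ 1 := by exact_mod_cast h1
  have h2' : ((s.filter fun j => p ∈ Q j ∧ 2 * (Q j \ R).card ≤ Fintype.card α - R.card).card : ℝ)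
    ≤ 1 := by exact_mod_cast h2
  rw [h3, card_empty, Nat.cast_zero]
  linarith

end Shearer

/-! ### Change of measure from uniform permutations to `G`. -/

section ChangeOfMeasure

variable {α : Type*} [DecidableEq α] [Fintype α]

theorem card_agreeing_univ (R : Finset α) (σ : Perm α) :
    (agreeing univ R σ).card = (Fintype.card α - R.card).factorial := by
  have h1 : Fintype.card {f : Perm α // ∀ a, ¬ a ∉ R → f a = a} =
      (Fintype.card α - R.card).factorial := by
    rw [← Fintype.card_congr (Equiv.Perm.subtypeEquivSubtypePerm fun a => a ∉ R), Fintype.card_perm,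
      Fintype.card_subtype_compl, Fintype.card_coe]
  rw [← h1, Fintype.card_subtype]
  refine card_bij' (fun τ _ => σ⁻¹ * τ) (fun f _ => σ * f) ?_ ?_ ?_ ?_
  · intro τ hτ
    simp only [mem_filter, mem_univ, true_and, not_not]
    intro a ha
    rw [Perm.mul_apply, (mem_agreeing.1 hτ).2 a ha]; simp
  · intro f hf
    simp only [mem_filter, mem_univ, true_and, not_not] at hf
    exact mem_agreeing.2 ⟨mem_univ _, fun x hx => by rw [Perm.mul_apply, hf x hx]⟩
  · intros; simp
  · intros; simp

/-- An event that depends on the restriction to `R` has probability not much larger under the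
uniform law on `G` than under the uniform law on all permutations, unless the relative entropy of
the restriction to `R` given the restriction to `F` is large. -/
theorem mul_card_filter_le (G : Finset (Perm α)) {F R : Finset α} (hFR : F ⊆ R)
    (P : Perm α → Prop) [DecidablePred P]
    (hP : ∀ σ τ : Perm α, (∀ x ∈ R, τ x = σ x) → (P τ ↔ P σ)) (μ : ℝ) :
    μ * (G.filter P).card ≤ restrEntropy G R - restrEntropy G F + (Real.exp μ - 1) *
      ∑ σ ∈ G, (((agreeing univ F σ).filter P).card : ℝ) / (agreeing univ F σ).card := by
  set aF : ℝ := ((Fintype.card α - F.card).factorial : ℝ) with haF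
  set aR : ℝ := ((Fintype.card α - R.card).factorial : ℝ) with haR
  have haF0 : 0 < aF := by positivity
  have haR0 : 0 < aR := by positivity
  -- The exponential tilt of the Donsker–Varadhan inequality; `log x ≥ 1 - 1/x` is applied to the
  -- likelihood ratio divided by it.
  set e : Perm α → ℝ := fun σ => Real.exp (μ * if P σ then 1 else 0) with he
  have hlog : ∑ σ ∈ G, Real.log ((agreeing G R σ).card / aR * (aF / (agreeing G F σ).card) / e σ) =
      restrEntropy G R - restrEntropy G F - μ * (G.filter P).card := by
    rw [restrEntropy, restrEntropy, ← sum_boole, mul_sum, ← sum_sub_distrib, ← sum_sub_distrib]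
    refine sum_congr rfl fun σ hσ => ?_
    have h1 := card_agreeing_pos (R := R) hσ
    have h2 := card_agreeing_pos (R := F) hσ
    rw [Real.log_div (by positivity) (Real.exp_pos _).ne',
      Real.log_mul (by positivity) (by positivity), Real.log_exp,
      Real.log_div haF0.ne' h2.ne', Real.log_div (x := ((agreeing G F σ).card : ℝ)) h2.ne' haF0.ne']
    ring
  have hle : ∑ σ ∈ G, (1 - ((agreeing G R σ).card / aR * (aF / (agreeing G F σ).card) / e σ)⁻¹) ≤
      ∑ σ ∈ G, Real.log ((agreeing G R σ).card / aR * (aF / (agreeing G F σ).card) / e σ) := by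
    refine sum_le_sum fun σ hσ => Real.one_sub_inv_le_log_of_pos ?_
    have h1 := card_agreeing_pos (R := R) hσ
    have h2 := card_agreeing_pos (R := F) hσ
    have := Real.exp_pos (μ * if P σ then 1 else 0)
    positivity
  -- The inverse ratios integrate the tilt against the reference law: draw `σ` from `G`, keep its
  -- values on `F`, and complete them uniformly.
  have hmain : ∑ σ ∈ G, ((agreeing G R σ).card / aR * (aF / (agreeing G F σ).card) / e σ)⁻¹ ≤
      G.card + (Real.exp μ - 1) *
      ∑ σ ∈ G, (((agreeing univ F σ).filter P).card : ℝ) / (agreeing univ F σ).card := by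
    calc _ = ∑ σ ∈ G, ∑ π ∈ agreeing univ R σ,
            (e π * (agreeing G F π).card / aF) * (1 / (agreeing G R π).card) := by
          refine sum_congr rfl fun σ hσ => ?_
          have h1 := card_agreeing_pos (R := R) hσ
          have h2 := card_agreeing_pos (R := F) hσ
          rw [sum_congr rfl (g := fun _ => (e σ * (agreeing G F σ).card / aF)
            * (1 / (agreeing G R σ).card)), sum_const, card_agreeing_univ, nsmul_eq_mul]
          · have := Real.exp_pos (μ * if P σ then 1 else 0)
            simp only [← haR]
            field_simp
          · intro π hπ
            have hπ' := (mem_agreeing.1 hπ).2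
            rw [agreeing_congr hπ', agreeing_congr fun x hx => hπ' x (hFR hx)]
            simp only [he, hP σ π hπ']
      _ = ∑ π, ∑ σ ∈ agreeing G R π,
            (e π * (agreeing G F π).card / aF) * (1 / (agreeing G R π).card) := by
          refine sum_comm' fun σ π => ?_
          simp only [mem_agreeing, mem_univ, true_and, and_true]
          exact and_congr_right fun _ => forall₂_congr fun _ _ => eq_comm
      -- Only an inequality, because a permutation may agree on `R` with no member of `G`.
      _ ≤ ∑ π, (e π * (agreeing G F π).card / aF) := by
          refine sum_le_sum fun π _ => ?_
          rw [sum_const, nsmul_eq_mul, mul_left_comm, ← div_eq_mul_one_div]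
          exact mul_le_of_le_one_right (by positivity) (div_self_le_one _)
      _ = ∑ π, ∑ σ ∈ agreeing G F π, e π / aF := by
          refine sum_congr rfl fun π _ => ?_
          rw [sum_const, nsmul_eq_mul]; ring
      _ = ∑ σ ∈ G, ∑ π ∈ agreeing univ F σ, e π / aF := by
          refine sum_comm' fun π σ => ?_
          simp only [mem_agreeing, mem_univ, true_and]
          rw [and_comm]
          exact and_congr_left fun _ => forall₂_congr fun _ _ => eq_comm
      _ = ∑ σ ∈ G, (1 + (Real.exp μ - 1) *
            ((((agreeing univ F σ).filter P).card : ℝ) / (agreeing univ F σ).card)) := by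
          refine sum_congr rfl fun σ _ => ?_
          have h : ∀ π, e π = 1 + (Real.exp μ - 1) * (if P π then 1 else 0) := by
            intro π; by_cases h : P π <;> simp [he, h]
          rw [← sum_div, sum_congr rfl fun π _ => h π, sum_add_distrib, ← mul_sum, sum_boole,
            sum_const, card_agreeing_univ, nsmul_eq_mul, mul_one, ← haF]
          field_simp
      _ = _ := by rw [sum_add_distrib, ← mul_sum]; simp
  rw [sum_sub_distrib, sum_const, nsmul_eq_mul, mul_one, hlog] at hle
  linarith

end ChangeOfMeasure

/-! ### Non-adaptive algorithms: collisions, and success on a set of encodings. -/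

/-- The point at which the `i`-th query evaluates the encoding if the secret is `d`. -/
def OnlineAlg.point {N : ℕ} (b : OnlineAlg N) (d : ZMod N) (i : Fin b.numQueries) : ZMod N :=
  (b.query i).1 * d + (b.query i).2

/-- The points queried independently of the secret. -/
def OnlineAlg.fixedPoints {N : ℕ} (b : OnlineAlg N) : Finset (ZMod N) :=
  (univ.filter fun i => (b.query i).1 = 0).image fun i => (b.query i).2

/-- The points of the queries that depend on the secret. -/
def OnlineAlg.movingPoints {N : ℕ} (b : OnlineAlg N) (d : ZMod N) : Finset (ZMod N) :=
  (univ.filter fun i => (b.query i).1 ≠ 0).image (b.point d)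

/-- Two queries with different slopes collide for the secret `d`. -/
def OnlineAlg.Collides {N : ℕ} (b : OnlineAlg N) (d : ZMod N) : Prop :=
  ∃ i j, (b.query i).1 ≠ (b.query j).1 ∧ b.point d i = b.point d j

theorem OnlineAlg.card_movingPoints_le {N : ℕ} (b : OnlineAlg N) (d : ZMod N) : (b.movingPoints d).card ≤ b.numQueries :=
  card_image_le.trans ((card_filter_le _ _).trans (by simp))

section Online

variable {N : ℕ} [Fact N.Prime] (b : OnlineAlg N)

theorem OnlineAlg.point_mem (d : ZMod N) (i : Fin b.numQueries) :
    b.point d i ∈ b.movingPoints d ∪ b.fixedPoints := by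
  simp only [OnlineAlg.movingPoints, OnlineAlg.fixedPoints, mem_union, mem_image, mem_filter,
    mem_univ, true_and]
  by_cases h : (b.query i).1 = 0
  · exact Or.inr ⟨i, h, by simp [OnlineAlg.point, h]⟩
  · exact Or.inl ⟨i, h, rfl⟩

theorem OnlineAlg.run_congr (d : ZMod N) {σ τ : Perm (ZMod N)}
    (h : ∀ x ∈ b.movingPoints d ∪ b.fixedPoints, τ x = σ x) : b.run τ d = b.run σ d := by
  unfold OnlineAlg.run
  congr 1
  funext i
  exact h _ (b.point_mem d i)

/-- A query of nonzero slope hits `p` for exactly one secret. This is the multiplicity bound for the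
Shearer-type inequality. -/
theorem OnlineAlg.card_filter_mem_movingPoints_le (s : Finset (ZMod N)) (p : ZMod N) :
    (s.filter fun d => p ∈ b.movingPoints d).card ≤ b.numQueries := by
  have : (s.filter fun d => p ∈ b.movingPoints d) ⊆
      univ.image fun i => (p - (b.query i).2) / (b.query i).1 := by
    intro d hd
    obtain ⟨i, hi, hip⟩ := mem_image.1 (mem_filter.1 hd).2
    have hi := (mem_filter.1 hi).2
    refine mem_image.2 ⟨i, mem_univ _, ?_⟩
    rw [← hip, OnlineAlg.point, add_sub_cancel_right, mul_div_cancel_left₀ _ hi]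
  exact (card_le_card this).trans (card_image_le.trans (by simp))

-- For a pair of queries with different slopes, a collision is a linear equation in `d` with nonzero
-- leading coefficient.
open Classical in
theorem OnlineAlg.card_collides_le :
    (univ.filter fun d => b.Collides d).card ≤ b.numQueries.choose 2 := by
  have hsub : (univ.filter fun d => b.Collides d) ⊆
      ((univ : Finset (Fin b.numQueries)).powersetCard 2).biUnion fun s =>
        univ.filter fun d => ∃ i ∈ s, ∃ j ∈ s,
          (b.query i).1 ≠ (b.query j).1 ∧ b.point d i = b.point d j := by
    intro d hd
    obtain ⟨i, j, hij, h⟩ := (mem_filter.1 hd).2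
    refine mem_biUnion.2 ⟨{i, j}, mem_powersetCard.2 ⟨subset_univ _, card_pair ?_⟩,
      mem_filter.2 ⟨mem_univ _, i, by simp, j, by simp, hij, h⟩⟩
    rintro rfl
    exact hij rfl
  refine (card_le_card hsub).trans ((card_biUnion_le_card_mul _ _ 1 fun s hs => ?_).trans
    (by simp))
  obtain ⟨x, y, _, rfl⟩ := card_eq_two.1 (mem_powersetCard.1 hs).2
  have key : ∀ d, (∃ i ∈ ({x, y} : Finset _), ∃ j ∈ ({x, y} : Finset _),
      (b.query i).1 ≠ (b.query j).1 ∧ b.point d i = b.point d j) →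
      (b.query x).1 - (b.query y).1 ≠ 0 ∧
      ((b.query x).1 - (b.query y).1) * d = (b.query y).2 - (b.query x).2 := by
    rintro d ⟨i, hi, j, hj, hij, h⟩
    simp only [mem_insert, mem_singleton] at hi hj
    simp only [OnlineAlg.point] at h
    rcases hi with rfl | rfl <;> rcases hj with rfl | rfl
    · exact absurd rfl hij
    · exact ⟨sub_ne_zero.2 hij, by linear_combination h⟩
    · exact ⟨sub_ne_zero.2 hij.symm, by linear_combination -h⟩
    · exact absurd rfl hij
  refine card_le_one.2 fun d hd d' hd' => ?_
  obtain ⟨h0, h1⟩ := key d (mem_filter.1 hd).2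
  obtain ⟨_, h2⟩ := key d' (mem_filter.1 hd').2
  exact mul_left_cancel₀ h0 (h1.trans h2.symm)

theorem OnlineAlg.point_eq_iff {d : ZMod N} (h : ¬ b.Collides d) (i j : Fin b.numQueries) :
    b.point d i = b.point d j ↔ b.query i = b.query j := by
  constructor
  · intro e
    have h1 : (b.query i).1 = (b.query j).1 := by
      by_contra hne
      exact h ⟨i, j, hne, e⟩
    refine Prod.ext h1 ?_
    simpa [OnlineAlg.point, h1] using e
  · intro e
    rw [OnlineAlg.point, OnlineAlg.point, e]

/-- Without collisions, two queries evaluate at the same point only if they are equal, so both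
secrets produce the same pattern of coincidences. -/
theorem OnlineAlg.exists_perm_point {d d' : ZMod N} (h : ¬ b.Collides d) (h' : ¬ b.Collides d') :
    ∃ ρ : Perm (ZMod N), ∀ i, ρ (b.point d i) = b.point d' i := by
  classical
  have hspec : ∀ x : Set.range (b.point d), b.point d x.2.choose = x := fun x => x.2.choose_spec
  have hinj : Function.Injective fun x : Set.range (b.point d) => b.point d' x.2.choose := by
    intro x y hxy
    have := (b.point_eq_iff h' _ _).1 hxy
    rw [Subtype.ext_iff, ← hspec x, ← hspec y]
    exact (b.point_eq_iff h _ _).2 this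
  obtain ⟨ρ, hρ⟩ := Equiv.Perm.exists_extending_pair (fun x : Set.range (b.point d) => (x : ZMod N))
    _ Subtype.val_injective hinj
  refine ⟨ρ, fun i => ?_⟩
  refine (hρ ⟨b.point d i, i, rfl⟩).trans ?_
  exact (b.point_eq_iff h' _ _).2 ((b.point_eq_iff h _ _).1 (hspec ⟨b.point d i, i, rfl⟩))

open Classical in
/-- Without preprocessing, the secrets that cause no collision are guessed with total probability
at most one. -/
theorem OnlineAlg.sum_card_run_eq_le {F : Finset (ZMod N)} (hF : F ⊆ b.fixedPoints)
    (σ : Perm (ZMod N)) :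
    ∑ d with ¬ b.Collides d, ((agreeing univ F σ).filter fun π => b.run π d = d).card ≤
      (agreeing univ F σ).card := by
  rcases (univ.filter fun d => ¬ b.Collides d).eq_empty_or_nonempty with h | ⟨d₀, hd₀⟩
  · simp [h]
  have hd₀ := (mem_filter.1 hd₀).2
  calc _ ≤ ∑ d with ¬ b.Collides d,
        ((agreeing univ F σ).filter fun π => b.output (fun i => π (b.point d₀ i)) = d).card := by
        refine sum_le_sum fun d hd => ?_
        -- `π * ρ` with secret `d₀` gives the answers of `π` with secret `d`. Since `ρ` leaves the
        -- fixed points in place, agreement with `σ` on `F` is preserved.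
        obtain ⟨ρ, hρ⟩ := b.exists_perm_point hd₀ (mem_filter.1 hd).2
        refine card_le_card_of_injOn (fun π => π * ρ) (fun π hπ => ?_)
          (fun _ _ _ _ e => mul_right_cancel e)
        obtain ⟨h1, h2⟩ := mem_filter.1 (mem_coe.1 hπ)
        refine mem_coe.2 (mem_filter.2 ⟨mem_agreeing.2 ⟨mem_univ _, fun x hx => ?_⟩, ?_⟩)
        · obtain ⟨i, hi, rfl⟩ := mem_image.1 (hF hx)
          have := hρ i
          simp only [OnlineAlg.point, (mem_filter.1 hi).2, zero_mul, zero_add] at this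
          rw [Perm.mul_apply, this]
          exact (mem_agreeing.1 h1).2 _ hx
        · simp only [Perm.mul_apply, hρ]
          exact h2
    _ ≤ ∑ d, ((agreeing univ F σ).filter fun π =>
          b.output (fun i => π (b.point d₀ i)) = d).card :=
        sum_le_sum_of_subset (filter_subset _ _)
    _ = _ := (card_eq_sum_card_fiberwise fun _ _ => mem_coe.2 (mem_univ _)).symm

/-- The number of pairs of an encoding in `G` and a secret for which the algorithm succeeds. -/
theorem OnlineAlg.sum_card_le_of_sum_noncolliding (G : Finset (Perm (ZMod N))) {T : ℕ}
    (hT : b.numQueries ≤ T) {B : ℝ}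
    (h : ∀ s : Finset (ZMod N), (∀ d, d ∈ s ↔ ¬ b.Collides d) →
      ∑ d ∈ s, ((G.filter fun σ => b.run σ d = d).card : ℝ) ≤ B) :
    ∑ d, ((G.filter fun σ => b.run σ d = d).card : ℝ) ≤ T.choose 2 * G.card + B := by
  classical
  rw [← sum_filter_add_sum_filter_not univ fun d => b.Collides d]
  refine add_le_add ?_ (h _ fun d => by simp)
  calc _ ≤ ∑ d with b.Collides d, (G.card : ℝ) :=
        sum_le_sum fun d _ => Nat.cast_le.2 (card_filter_le _ _)
    _ = (univ.filter fun d => b.Collides d).card * (G.card : ℝ) := by rw [sum_const, nsmul_eq_mul]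
    _ ≤ _ := by
      gcongr
      exact b.card_collides_le.trans (Nat.choose_le_choose 2 hT)

theorem OnlineAlg.sum_card_univ_le {T : ℕ} (hT : b.numQueries ≤ T) :
    ∑ d, ((univ.filter fun σ => b.run σ d = d).card : ℝ) ≤
      (T.choose 2 + 1) * Fintype.card (Perm (ZMod N)) := by
  rw [add_mul, one_mul, ← card_univ]
  refine b.sum_card_le_of_sum_noncolliding univ hT fun s hs => ?_
  classical
  have := b.sum_card_run_eq_le (empty_subset _) 1
  have hs' : s = univ.filter fun d => ¬ b.Collides d := by ext d; simp [hs]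
  simp only [agreeing, notMem_empty, false_imp_iff, implies_true, filter_true] at this
  rw [hs']
  exact_mod_cast this

/-- The success of an algorithm for the encodings in `G`. -/
theorem OnlineAlg.sum_card_le (G : Finset (Perm (ZMod N))) {T : ℕ} (hT : b.numQueries ≤ T)
    {K μ : ℝ} (hμ : 0 < μ) (hK : K = 6 * T ∨ T = 1 ∧ K = 4) :
    ∑ d, ((G.filter fun σ => b.run σ d = d).card : ℝ) ≤
      T.choose 2 * G.card + (K * (G.card * Real.log (Fintype.card (Perm (ZMod N)) / G.card))
        + (Real.exp μ - 1) * G.card) / μ := by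
  refine b.sum_card_le_of_sum_noncolliding G hT fun s hs => ?_
  classical
  have hs' : s = univ.filter fun d => ¬ b.Collides d := by ext d; simp [hs]
  have hK0 : 0 ≤ K := by rcases hK with rfl | ⟨_, rfl⟩ <;> positivity
  have hexp : 0 ≤ Real.exp μ - 1 := sub_nonneg.2 (Real.one_le_exp hμ.le)
  rw [le_div_iff₀ hμ, mul_comm, mul_sum]
  have hmult : ∀ p ∉ b.fixedPoints, (s.filter fun d => p ∈ b.movingPoints d).card ≤ T :=
    fun p _ => (b.card_filter_mem_movingPoints_le s p).trans hT
  have hent : ∑ d ∈ s, (restrEntropy G (b.movingPoints d ∪ b.fixedPoints)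
      - restrEntropy G b.fixedPoints) ≤
      K * (restrEntropy G univ - restrEntropy G b.fixedPoints) := by
    rcases hK with rfl | ⟨rfl, rfl⟩
    · exact sum_restrEntropy_le_six_mul G _ s _ T hmult
    · exact sum_restrEntropy_le_four_mul G _ s _
        (fun d _ => (b.card_movingPoints_le d).trans hT) hmult
  -- The entropy already spent on the fixed points is dropped.
  have hent' : K * (restrEntropy G univ - restrEntropy G b.fixedPoints) ≤
      K * (G.card * Real.log (Fintype.card (Perm (ZMod N)) / G.card)) := by
    refine mul_le_mul_of_nonneg_left ?_ hK0
    have h1 := restrEntropy_mono G (empty_subset b.fixedPoints)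
    rw [restrEntropy_empty, ← inv_div, Real.log_inv] at h1
    rw [restrEntropy_univ]
    linarith
  have hprob : ∑ d ∈ s, ∑ σ ∈ G, (((agreeing univ b.fixedPoints σ).filter
      fun π => b.run π d = d).card : ℝ) / (agreeing univ b.fixedPoints σ).card ≤ G.card := by
    rw [sum_comm]
    calc _ ≤ ∑ σ ∈ G, (1 : ℝ) := by
          refine sum_le_sum fun σ _ => ?_
          rw [← sum_div]
          refine div_le_one_of_le₀ ?_ (Nat.cast_nonneg _)
          rw [hs']
          exact_mod_cast b.sum_card_run_eq_le subset_rfl σ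
      _ = _ := by simp
  calc _ ≤ ∑ d ∈ s, (restrEntropy G (b.movingPoints d ∪ b.fixedPoints)
          - restrEntropy G b.fixedPoints + (Real.exp μ - 1) * ∑ σ ∈ G,
            (((agreeing univ b.fixedPoints σ).filter fun π => b.run π d = d).card : ℝ)
              / (agreeing univ b.fixedPoints σ).card) :=
        sum_le_sum fun d _ => mul_card_filter_le G subset_union_right _
          (fun σ τ h => by rw [b.run_congr d h]) μ
    _ ≤ _ := by
        rw [sum_add_distrib, ← mul_sum]
        exact add_le_add (hent.trans hent') (mul_le_mul_of_nonneg_left hprob hexp)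

end Online

/-! ### Averaging over coins and counting advice strings. -/

theorem PMF.hasSum_toReal {β : Type*} (p : PMF β) : HasSum (fun b => (p b).toReal) 1 := by
  have h := ENNReal.summable_toReal p.tsum_coe_ne_top
  have := ENNReal.tsum_toReal_eq p.apply_ne_top
  rw [p.tsum_coe, ENNReal.toReal_one] at this
  rw [this]
  exact h.hasSum

theorem PMF.tsum_toReal_mul_le {β : Type*} (p : PMF β) {f : β → ℝ} {C : ℝ} (hf : ∀ b, 0 ≤ f b)
    (hC : ∀ b ∈ p.support, f b ≤ C) : ∑' b, (p b).toReal * f b ≤ C := by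
  have hle : ∀ b, (p b).toReal * f b ≤ (p b).toReal * C := by
    intro b
    by_cases hb : b ∈ p.support
    · exact mul_le_mul_of_nonneg_left (hC b hb) ENNReal.toReal_nonneg
    · rw [p.apply_eq_zero_iff b |>.2 hb]; simp
  have hs : HasSum (fun b => (p b).toReal * C) C := by
    simpa using p.hasSum_toReal.mul_right C
  have hs' := Summable.of_nonneg_of_le (fun b => mul_nonneg ENNReal.toReal_nonneg (hf b)) hle
    hs.summable
  exact (hs'.tsum_le_tsum hle hs.summable).trans hs.tsum_eq.le

theorem card_listBool_le (S : ℕ) (Z : Finset (List Bool)) (hZ : ∀ z ∈ Z, z.length ≤ S) :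
    Z.card ≤ 2 ^ (S + 1) - 1 := by
  have hsub : Z ⊆ (range (S + 1)).biUnion fun n =>
      (univ : Finset (Fin n → Bool)).image fun f => List.ofFn f := by
    intro z hz
    refine mem_biUnion.2 ⟨z.length, mem_range.2 (Nat.lt_succ_of_le (hZ z hz)), ?_⟩
    exact mem_image.2 ⟨z.get, mem_univ _, List.ofFn_get z⟩
  calc Z.card ≤ ∑ n ∈ range (S + 1), 2 ^ n := by
        refine (card_le_card hsub).trans (card_biUnion_le.trans (sum_le_sum fun n _ => ?_))
        exact card_image_le.trans (by simp)
    _ = 2 ^ (S + 1) - 1 := by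
        have := Nat.geomSum_eq (le_refl 2) (S + 1)
        simpa using this

theorem dlogProb_eq (N : ℕ) [NeZero N] (f : Perm (ZMod N) → ZMod N → ZMod N) :
    dlogProb N f = (∑ d, ((univ.filter fun σ => f σ d = d).card : ℝ)) /
      (Fintype.card (Perm (ZMod N)) * N) := by
  rw [dlogProb, Fintype.card_prod, ZMod.card, Nat.cast_mul]
  congr 1
  simp only [card_filter, Nat.cast_sum]
  rw [← univ_product_univ, sum_product_right]

theorem dlogProb_nonneg (N : ℕ) [NeZero N] (f : Perm (ZMod N) → ZMod N → ZMod N) :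
    0 ≤ dlogProb N f := by
  unfold dlogProb; positivity

theorem dlogProb_le_one (N : ℕ) [NeZero N] (f : Perm (ZMod N) → ZMod N → ZMod N) :
    dlogProb N f ≤ 1 :=
  div_le_one_of_le₀ (Nat.cast_le.2 (card_filter_le _ _)) (Nat.cast_nonneg _)

/-- The entropy of `φ` under the uniform law on `s` is at most the logarithm of the number of its
values. -/
theorem sum_card_mul_log_le {β γ : Type*} [DecidableEq γ] (s : Finset β) (φ : β → γ) :
    ∑ z ∈ s.image φ, ((s.filter fun x => φ x = z).card : ℝ) *
      Real.log (s.card / (s.filter fun x => φ x = z).card) ≤ s.card * Real.log (s.image φ).card := by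
  rcases s.eq_empty_or_nonempty with rfl | hs
  · simp
  have hm : (0 : ℝ) < (s.image φ).card := Nat.cast_pos.2 (card_pos.2 (hs.image φ))
  have hs0 : (0 : ℝ) < s.card := Nat.cast_pos.2 (card_pos.2 hs)
  have hcard : ∑ z ∈ s.image φ, ((s.filter fun x => φ x = z).card : ℝ) = s.card := by
    exact_mod_cast (card_eq_sum_card_image φ s).symm
  calc _ ≤ ∑ z ∈ s.image φ, (((s.filter fun x => φ x = z).card : ℝ) * Real.log (s.image φ).card
          + (s.card / (s.image φ).card - (s.filter fun x => φ x = z).card)) := by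
        refine sum_le_sum fun z hz => ?_
        have hz : (0 : ℝ) < (s.filter fun x => φ x = z).card := by
          obtain ⟨x, hx, rfl⟩ := mem_image.1 hz
          exact Nat.cast_pos.2 (card_pos.2 ⟨x, by simp [hx]⟩)
        have := Real.log_le_sub_one_of_pos
          (x := s.card / (s.filter fun x => φ x = z).card / (s.image φ).card) (by positivity)
        rw [Real.log_div (by positivity) hm.ne'] at this
        have h2 := mul_le_mul_of_nonneg_left this hz.le
        have h3 : ((s.filter fun x => φ x = z).card : ℝ) *
            (s.card / (s.filter fun x => φ x = z).card / (s.image φ).card - 1) =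
            s.card / (s.image φ).card - (s.filter fun x => φ x = z).card := by
          field_simp
        linarith
    _ = _ := by
        rw [sum_add_distrib, sum_sub_distrib, ← sum_mul, hcard, sum_const, nsmul_eq_mul]
        field_simp; ring

/-! ### Success with preprocessing, with free parameter `μ`. -/

section Preprocessing

variable {N : ℕ} [Fact N.Prime]

theorem PreprocAlg.dlogProb_run_le (A : PreprocAlg N) {S T : ℕ} (hA : A.IsST S T) {K μ : ℝ}
    (hμ : 0 < μ) (hK : K = 6 * T ∨ T = 1 ∧ K = 4) :
    ∃ m : ℕ, 1 ≤ m ∧ m ≤ 2 ^ (S + 1) - 1 ∧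
      dlogProb N A.run ≤ (T.choose 2 + (K * Real.log m + (Real.exp μ - 1)) / μ) / N := by
  have hK0 : 0 ≤ K := by rcases hK with rfl | ⟨_, rfl⟩ <;> positivity
  have hN : (0 : ℝ) < N := Nat.cast_pos.2 (Fact.out : N.Prime).pos
  set Z := (univ : Finset (Perm (ZMod N))).image A.advice with hZ
  set C : ℝ := (Fintype.card (Perm (ZMod N)) : ℝ) with hC
  have hC0 : 0 < C := Nat.cast_pos.2 Fintype.card_pos
  refine ⟨Z.card, card_pos.2 (univ_nonempty.image _), card_listBool_le S Z fun z hz => ?_, ?_⟩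
  · obtain ⟨σ, _, rfl⟩ := mem_image.1 hz
    exact hA.1 σ
  set G : List Bool → Finset (Perm (ZMod N)) := fun z => univ.filter fun σ => A.advice σ = z with hG
  have hcard : ∑ z ∈ Z, ((G z).card : ℝ) = C := by
    rw [hC, ← card_univ]
    exact_mod_cast (card_eq_sum_card_image A.advice univ).symm
  have hlog : ∑ z ∈ Z, ((G z).card : ℝ) * Real.log (C / (G z).card) ≤ C * Real.log Z.card := by
    simpa only [card_univ] using sum_card_mul_log_le (univ : Finset (Perm (ZMod N))) A.advice
  have hsum : ∑ d, ((univ.filter fun σ => A.run σ d = d).card : ℝ) ≤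
      T.choose 2 * C + (K * (C * Real.log Z.card) + (Real.exp μ - 1) * C) / μ := by
    calc _ = ∑ d, ∑ z ∈ Z, (((G z).filter fun σ => (A.online z).run σ d = d).card : ℝ) := by
          refine sum_congr rfl fun d _ => ?_
          rw [card_eq_sum_card_fiberwise (f := A.advice) (t := Z)
            fun σ _ => mem_coe.2 (mem_image_of_mem _ (mem_univ σ)), Nat.cast_sum]
          refine sum_congr rfl fun z _ => ?_
          refine congrArg Nat.cast (congrArg card ?_)
          ext σ
          simp only [hG, mem_filter, mem_univ, true_and]
          rw [and_comm]
          exact and_congr_right fun h => by rw [PreprocAlg.run, h]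
      _ ≤ ∑ z ∈ Z, (T.choose 2 * (G z).card + (K * ((G z).card * Real.log (C / (G z).card))
            + (Real.exp μ - 1) * (G z).card) / μ) := by
          rw [sum_comm]
          exact sum_le_sum fun z _ => (A.online z).sum_card_le (G z) (hA.2 z) hμ hK
      _ = T.choose 2 * C + (K * ∑ z ∈ Z, ((G z).card * Real.log (C / (G z).card))
            + (Real.exp μ - 1) * C) / μ := by
          rw [sum_add_distrib, ← mul_sum, ← sum_div, sum_add_distrib, ← mul_sum, ← mul_sum, hcard]
      _ ≤ _ := by gcongr
  rw [dlogProb_eq, ← hC, div_le_div_iff₀ (by positivity) hN]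
  calc _ ≤ (T.choose 2 * C + (K * (C * Real.log Z.card) + (Real.exp μ - 1) * C) / μ) * N := by
        gcongr
    _ = _ := by field_simp

theorem OnlineAlg.dlogProb_run_le (b : OnlineAlg N) {T : ℕ} (hT : b.numQueries ≤ T) :
    dlogProb N b.run ≤ (T.choose 2 + 1) / N := by
  have hN : (0 : ℝ) < N := Nat.cast_pos.2 (Fact.out : N.Prime).pos
  have hC : (0 : ℝ) < Fintype.card (Perm (ZMod N)) := Nat.cast_pos.2 Fintype.card_pos
  rw [dlogProb_eq, mul_comm, ← div_div, div_right_comm]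
  gcongr
  rw [div_le_iff₀ hC]
  exact b.sum_card_univ_le hT

end Preprocessing

/-! ### Numerical constants and the explicit bounds. -/

theorem cast_choose_two_real (T : ℕ) : (T.choose 2 : ℝ) = T * (T - 1) / 2 :=
  Nat.cast_choose_two ℝ T

theorem exp_two_sub_one_div_two_le : (Real.exp 2 - 1) / 2 ≤ 3.195 := by
  have h : Real.exp 2 = Real.exp 1 ^ 2 := by rw [← Real.exp_nat_mul]; norm_num
  have h1 := Real.exp_one_lt_d9
  have h2 : Real.exp 1 ^ 2 ≤ 2.7182818286 ^ 2 := by gcongr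
  norm_num at h2 ⊢
  linarith

theorem log_le_of_le_two_pow_sub_one {m S : ℕ} (hm : 1 ≤ m) (h : m ≤ 2 ^ (S + 1) - 1) :
    Real.log m ≤ (S + 1) * Real.log 2 := by
  have : Real.log m ≤ Real.log (2 ^ (S + 1)) := by
    refine Real.log_le_log (Nat.cast_pos.2 hm) ?_
    exact_mod_cast h.trans (Nat.sub_le _ _)
  rwa [Real.log_pow, Nat.cast_succ] at this

section Bounds

variable {N : ℕ} [Fact N.Prime]

theorem PreprocAlg.dlogProb_run_le_two_add (A : PreprocAlg N) {S T : ℕ} (hA : A.IsST S T) :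
    dlogProb N A.run ≤ (2 + 4 * Real.log 2 * (S * T) + (T : ℝ) ^ 2) / N := by
  have hl2 := Real.log_two_gt_d9
  have hl2' := Real.log_two_lt_d9
  have he1 := Real.exp_one_lt_d9
  have he2 := exp_two_sub_one_div_two_le
  rcases Nat.eq_zero_or_pos (S * T) with h0 | h0
  · obtain ⟨m, hm1, hm, h⟩ := A.dlogProb_run_le hA one_pos (Or.inl rfl)
    refine h.trans ?_
    have hz : (T : ℝ) * Real.log m = 0 := by
      rcases Nat.mul_eq_zero.1 h0 with rfl | rfl
      · have : m = 1 := by simp at hm; omega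
        simp [this]
      · simp
    have h0' : (S : ℝ) * T = 0 := by exact_mod_cast h0
    rw [h0', cast_choose_two_real]
    refine div_le_div_of_nonneg_right ?_ (Nat.cast_nonneg N)
    have hT : (T : ℝ) * (T - 1) / 2 ≤ T ^ 2 := by
      have : (0 : ℝ) ≤ T := Nat.cast_nonneg T
      nlinarith
    linarith
  have hS : 1 ≤ S := Nat.pos_of_mul_pos_right h0
  have hT : 1 ≤ T := Nat.pos_of_mul_pos_left h0
  have hS' : (1 : ℝ) ≤ S := Nat.one_le_cast.2 hS
  -- For `S = 1` the exact count of three strings is needed, because `log 4` would break both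
  -- bounds; from `S = 2` on, `m ≤ 2 ^ (S + 1)` is enough.
  have hlog : ∀ m : ℕ, 1 ≤ m → m ≤ 2 ^ (S + 1) - 1 →
      Real.log m ≤ 2 * Real.log 2 * S - 0.1 ∧ 3 * Real.log m ≤ 4 * Real.log 2 * S + 0.9 := by
    intro m hm1 hm
    rcases hS.eq_or_lt with rfl | hS2
    · have h3 : Real.log m ≤ Real.log 3 :=
        Real.log_le_log (Nat.cast_pos.2 hm1) (by exact_mod_cast hm)
      have h4 : Real.log 3 ≤ 2 * Real.log 2 - 1 / 4 := by
        have := Real.log_le_sub_one_of_pos (x := 3 / 4) (by norm_num)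
        rw [Real.log_div (by norm_num) (by norm_num), show (4 : ℝ) = 2 ^ 2 by norm_num,
          Real.log_pow] at this
        push_cast at this; linarith
      have h5 : 3 * Real.log 3 ≤ 4 * Real.log 2 + 0.9 := by
        have := Real.log_le_sub_one_of_pos (x := 3 ^ 3 / 2 ^ 4) (by norm_num)
        rw [Real.log_div (by norm_num) (by norm_num), Real.log_pow, Real.log_pow] at this
        push_cast at this; linarith
      constructor <;> push_cast <;> linarith
    · have h1 := log_le_of_le_two_pow_sub_one hm1 hm
      have hS2' : (2 : ℝ) ≤ S := by exact_mod_cast hS2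
      constructor <;> nlinarith
  rcases hT.eq_or_lt with rfl | hT2
  · obtain ⟨m, hm1, hm, h⟩ := A.dlogProb_run_le hA two_pos (Or.inr ⟨rfl, rfl⟩)
    refine h.trans ?_
    have := (hlog m hm1 hm).1
    refine div_le_div_of_nonneg_right ?_ (Nat.cast_nonneg N)
    norm_num at he2 ⊢
    norm_num at this
    linarith
  · obtain ⟨m, hm1, hm, h⟩ := A.dlogProb_run_le hA two_pos (Or.inl rfl)
    refine h.trans ?_
    have h1 := (hlog m hm1 hm).2
    have hT' : (2 : ℝ) ≤ T := by exact_mod_cast hT2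
    have h2 := mul_le_mul_of_nonneg_left h1 (zero_le_two.trans hT')
    rw [cast_choose_two_real]
    refine div_le_div_of_nonneg_right ?_ (Nat.cast_nonneg N)
    norm_num at he2 h2 ⊢
    nlinarith

theorem onlineSuccess_pure (b : OnlineAlg N) : onlineSuccess (PMF.pure b) = dlogProb N b.run := by
  rw [onlineSuccess, tsum_eq_single b]
  · simp
  · intro b' hb'; simp [PMF.pure_apply, hb']

/-- A constant guess without queries achieves this. It lets `2 * maxSDLOG N T` absorb the summand `2
/ N`. -/
theorem one_div_le_maxSDLOG (T : ℕ) : 1 / (N : ℝ) ≤ maxSDLOG N T := by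
  have hN : (0 : ℝ) < N := Nat.cast_pos.2 (Fact.out : N.Prime).pos
  have hC : (0 : ℝ) < Fintype.card (Perm (ZMod N)) := Nat.cast_pos.2 Fintype.card_pos
  refine le_csSup ⟨1, ?_⟩ ⟨PMF.pure ⟨0, Fin.elim0, fun _ => 0⟩, ?_, ?_⟩
  · rintro p ⟨B, _, rfl⟩
    exact B.tsum_toReal_mul_le (fun b => dlogProb_nonneg N _) fun b _ => dlogProb_le_one N _
  · intro b hb
    rw [PMF.mem_support_pure_iff] at hb
    subst hb
    exact Nat.zero_le T
  · rw [onlineSuccess_pure, dlogProb_eq]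
    have : ∀ d : ZMod N, ((univ.filter fun σ : Perm (ZMod N) =>
        OnlineAlg.run (⟨0, Fin.elim0, fun _ => 0⟩ : OnlineAlg N) σ d = d).card : ℝ) =
        if d = 0 then (Fintype.card (Perm (ZMod N)) : ℝ) else 0 := by
      intro d
      by_cases hd : d = 0
      · simp [OnlineAlg.run, hd]
      · simp [OnlineAlg.run, hd, Ne.symm hd]
    rw [sum_congr rfl fun d _ => this d, sum_ite_eq' univ, if_pos (mem_univ _)]
    field_simp

theorem maxSDLOG_le (T : ℕ) : maxSDLOG N T ≤ (T.choose 2 + 1) / N := by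
  refine csSup_le ⟨_, PMF.pure ⟨0, Fin.elim0, fun _ => 0⟩, ?_, rfl⟩ ?_
  · intro b hb
    rw [PMF.mem_support_pure_iff] at hb
    subst hb
    exact Nat.zero_le T
  · rintro p ⟨B, hB, rfl⟩
    exact B.tsum_toReal_mul_le (fun b => dlogProb_nonneg N _) fun b hb => b.dlogProb_run_le (hB b hb)

theorem maxSDLOG_le_sq_div {T : ℕ} (hT : 1 ≤ T) : maxSDLOG N T ≤ (T : ℝ) ^ 2 / N := by
  refine (maxSDLOG_le T).trans ?_
  rw [cast_choose_two_real]
  have : (1 : ℝ) ≤ T := Nat.one_le_cast.2 hT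
  gcongr
  nlinarith

theorem preprocSuccess_le {S T : ℕ} (A : PMF (PreprocAlg N)) (hA : IsSTAlg A S T) :
    preprocSuccess A ≤
      2 * maxSDLOG N T + 4 * Real.log 2 * (S * T) / N + (T : ℝ) ^ 2 / N := by
  refine (A.tsum_toReal_mul_le (fun a => dlogProb_nonneg N _)
    fun a ha => a.dlogProb_run_le_two_add (hA a ha)).trans ?_
  have := one_div_le_maxSDLOG (N := N) T
  rw [add_div, add_div, ← mul_one_div 2 (N : ℝ)]
  linarith

/-! ### Baby-step giant-step. -/

/-- The baby-step giant-step algorithm with `m` baby steps and `m` giant steps. -/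
noncomputable def babyStepGiantStep (N m : ℕ) : OnlineAlg N where
  numQueries := m + m
  query := Fin.append (fun i : Fin m => (0, ((i : ℕ) : ZMod N)))
    fun j : Fin m => (1, -((m * j : ℕ) : ZMod N))
  output y := by
    classical
    -- Any matching pair determines `d`, so the choice is immaterial; the default 0 is never reached
    -- when `N ≤ m * m`.
    exact if h : ∃ ij : Fin m × Fin m, y (Fin.castAdd m ij.1) = y (Fin.natAdd m ij.2) then
      ((m * h.choose.2 + h.choose.1 : ℕ) : ZMod N) else 0

theorem babyStepGiantStep_run {m : ℕ} (hm : N ≤ m * m) (σ : Perm (ZMod N)) (d : ZMod N) :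
    (babyStepGiantStep N m).run σ d = d := by
  set y : Fin (m + m) → ZMod N := fun k => σ (((babyStepGiantStep N m).query k).1 * d
    + ((babyStepGiantStep N m).query k).2) with hy
  have hyl : ∀ i : Fin m, y (Fin.castAdd m i) = σ ((i : ℕ) : ZMod N) := by
    intro i; simp [hy, babyStepGiantStep]
  have hyr : ∀ j : Fin m, y (Fin.natAdd m j) = σ (d - ((m * j : ℕ) : ZMod N)) := by
    intro j
    simp only [hy, babyStepGiantStep, Fin.append_right, one_mul, sub_eq_add_neg]
  have hd : d.val < m * m := (ZMod.val_lt d).trans_le hm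
  have hm0 : 0 < m := Nat.pos_of_ne_zero (by rintro rfl; simp at hd)
  have h : ∃ ij : Fin m × Fin m, y (Fin.castAdd m ij.1) = y (Fin.natAdd m ij.2) := by
    refine ⟨(⟨d.val % m, Nat.mod_lt _ hm0⟩, ⟨d.val / m, Nat.div_lt_of_lt_mul hd⟩), ?_⟩
    rw [hyl, hyr]
    congr 1
    rw [eq_sub_iff_add_eq, ← Nat.cast_add, Nat.mod_add_div, ZMod.natCast_zmod_val]
  have hrun : (babyStepGiantStep N m).run σ d =
      ((m * h.choose.2 + h.choose.1 : ℕ) : ZMod N) := dif_pos h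
  have hs := h.choose_spec
  rw [hyl, hyr] at hs
  rw [hrun, Nat.cast_add, σ.injective hs]
  ring

theorem exists_onlineAlg_dlogProb_eq_one (N : ℕ) [Fact N.Prime] : ∃ b : OnlineAlg N,
    b.numQueries ≤ 2 * ⌈√(N : ℝ)⌉₊ ∧ dlogProb N b.run = 1 := by
  refine ⟨babyStepGiantStep N ⌈√(N : ℝ)⌉₊, (two_mul _).ge, ?_⟩
  have hm : N ≤ ⌈√(N : ℝ)⌉₊ * ⌈√(N : ℝ)⌉₊ := by
    have h := Nat.le_ceil (√(N : ℝ))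
    have : (N : ℝ) ≤ ⌈√(N : ℝ)⌉₊ * ⌈√(N : ℝ)⌉₊ := by
      calc (N : ℝ) = √(N : ℝ) * √(N : ℝ) := (Real.mul_self_sqrt (Nat.cast_nonneg N)).symm
        _ ≤ _ := by gcongr
    exact_mod_cast this
  rw [dlogProb, filter_true_of_mem fun x _ => babyStepGiantStep_run hm x.1 x.2, card_univ,
    div_self (Nat.cast_ne_zero.2 Fintype.card_ne_zero)]

theorem two_mul_maxSDLOG_add_le (S : ℕ) {T : ℕ} (hT : 1 ≤ T) :
    2 * maxSDLOG N T + 4 * Real.log 2 * (S * T) / N + (T : ℝ) ^ 2 / N ≤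
      3 * (T : ℝ) ^ 2 / N + 4 * Real.log 2 * (S * T) / N := by
  have := maxSDLOG_le_sq_div (N := N) hT
  have h3 : 3 * (T : ℝ) ^ 2 / N = 3 * ((T : ℝ) ^ 2 / N) := by ring
  linarith

end Bounds

/-! ### The lower bound of order `√N` on the number of queries. -/

theorem exists_mul_sqrt_le (ε C : ℝ) (hε : 0 < ε) (hC : 0 < C) : ∃ c : ℝ, 0 < c ∧
    ∀ (N : ℕ) [Fact N.Prime] (S T : ℕ) (A : PMF (PreprocAlg N)), 1 ≤ T → IsSTAlg A S T →
      (S : ℝ) ≤ C * √(N : ℝ) → ε ≤ preprocSuccess A → c * √(N : ℝ) ≤ T := by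
  have hl : 0 < Real.log 2 := Real.log_pos one_lt_two
  set D : ℝ := 3 + 4 * Real.log 2 * C with hD
  have hD0 : 0 < D := by positivity
  -- With `x = T / √N` the success probability is at most `3 * x ^ 2 + 4 * log 2 * C * x`, which is
  -- at most `D * x` for `x ≤ 1`.
  refine ⟨min 1 (ε / D), by positivity, fun N _ S T A hT hA hS hε' => ?_⟩
  by_contra! hlt
  have hN : (0 : ℝ) < N := Nat.cast_pos.2 (Fact.out : N.Prime).pos
  have hr : 0 < √(N : ℝ) := Real.sqrt_pos.2 hN
  have hrr : √(N : ℝ) ^ 2 = N := Real.sq_sqrt hN.le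
  have h := hε'.trans ((preprocSuccess_le A hA).trans (two_mul_maxSDLOG_add_le S hT))
  rw [← hrr] at h
  set r := √(N : ℝ)
  set x : ℝ := T / r with hx
  have hTx : (T : ℝ) = x * r := by rw [hx]; field_simp
  have hx0 : 0 ≤ x := by positivity
  have hxlt : x < min 1 (ε / D) := by rwa [hx, div_lt_iff₀ hr]
  have hx1 : x < 1 := hxlt.trans_le (min_le_left _ _)
  have hx2 : x * D < ε := (lt_div_iff₀ hD0).1 (hxlt.trans_le (min_le_right _ _))
  have h1 : 3 * (T : ℝ) ^ 2 / r ^ 2 = 3 * x ^ 2 := by rw [hTx]; field_simp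
  have h2 : 4 * Real.log 2 * (S * T) / r ^ 2 ≤ 4 * Real.log 2 * C * x := by
    calc 4 * Real.log 2 * (S * T) / r ^ 2 ≤ 4 * Real.log 2 * ((C * r) * T) / r ^ 2 := by gcongr
      _ = _ := by rw [hTx]; field_simp
  have h3 : x ^ 2 ≤ x := by nlinarith
  rw [h1] at h
  have : x * D = 3 * x + 4 * Real.log 2 * C * x := by rw [hD]; ring
  linarith

end

theorem theorem1 :
    -- the bound on the success probability of an `(S, T)`-algorithm
    (∀ (N : ℕ) [Fact N.Prime] (S T : ℕ) (A : PMF (PreprocAlg N)), IsSTAlg A S T →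
      preprocSuccess A ≤
        2 * maxSDLOG N T + 4 * Real.log 2 * (S * T) / N + (T : ℝ) ^ 2 / N) ∧
    -- the explicit form of the bound
    (∀ (N : ℕ) [Fact N.Prime] (S T : ℕ), 1 ≤ T →
      2 * maxSDLOG N T + 4 * Real.log 2 * (S * T) / N + (T : ℝ) ^ 2 / N ≤
        3 * (T : ℝ) ^ 2 / N + 4 * Real.log 2 * (S * T) / N) ∧
    -- constant success probability with `O(√N)` bits of advice requires `Ω(√N)` queries
    (∀ ε C : ℝ, 0 < ε → 0 < C → ∃ c : ℝ, 0 < c ∧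
      ∀ (N : ℕ) [Fact N.Prime] (S T : ℕ) (A : PMF (PreprocAlg N)), 1 ≤ T → IsSTAlg A S T →
        (S : ℝ) ≤ C * √(N : ℝ) → ε ≤ preprocSuccess A → c * √(N : ℝ) ≤ T) ∧
    -- `O(√N)` queries suffice without any advice (baby-step giant-step)
    (∀ (N : ℕ) [Fact N.Prime], ∃ b : OnlineAlg N,
      b.numQueries ≤ 2 * ⌈√(N : ℝ)⌉₊ ∧ dlogProb N b.run = 1) :=
  ⟨fun _ _ _ _ A hA => preprocSuccess_le A hA, fun _ _ S _ hT => two_mul_maxSDLOG_add_le S hT,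
    exists_mul_sqrt_le, fun N _ => exists_onlineAlg_dlogProb_eq_one N⟩
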